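/- Let $\mathbb K=\mathbb R$ or $\mathbb C$, let $1\le n\le m$, and equip $V=\mathbb K^{n\times m}$ with the Frobenius Hermitian product $\langle M,N\rangle_F=\operatorname{trace}(N^*M)$ and norm $\|\cdot\|_F$. Let $\sigma_1(A)\ge\dots\ge\sigma_n(A)\ge 0$ be the singular values of $A\in V$, and let $\mathbb{GL}^>_{n,m}\subset V$ be the set of matrices of rank $n$ whose smallest singular value is simple, that is, $\sigma_n(A)>0$ and $\sigma_i(A)>\sigma_n(A)$ for all $i<n$. Let $\mathbb P(V)$ be the projective space of $\mathbb K$-lines in $V$, regarded as a real smooth manifold with its Fubini–Study metric, the unique Riemannian metric for which the canonical map from the unit sphere of $V$ (with the metric induced by $\operatorname{Re}\langle\cdot,\cdot\rangle_F$) to $\mathbb P(V)$ is a Riemannian submersion. Let $\mathbb P(\mathbb{GL}^>_{n,m})\subset\mathbb P(V)$ be the image of $\mathbb{GL}^>_{n,m}$. A function $\alpha$ on an open subset $U$ of a Riemannian manifold $(M,\langle\cdot,\cdot\rangle)$ that is of class $C^2$ with positive values is called self-convex on $U$ if, for every geodesic $\gamma$ in $U$ of the metric $\alpha(x)\langle\cdot,\cdot\rangle_x$,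 defined on an interval, the function $t\mapsto\log\alpha(\gamma(t))$ is convex. Then $\mathbb P(\mathbb{GL}^>_{n,m})$ is open in $\mathbb P(V)$, the function $$\alpha_2:\mathbb P(\mathbb{GL}^>_{n,m})\to\mathbb R,\qquad \alpha_2(A)=\|A\|_F^2\,\sigma_n(A)^{-2},$$ is of class $C^2$ with positive values, and $\alpha_2$ is self-convex on $\mathbb P(\mathbb{GL}^>_{n,m})$. -/

import Mathlib

open scoped Manifold ContDiff LinearAlgebra.Projectivization

theorem LinearMap.singularValues_smul {𝕜 E F : Type*} [RCLike 𝕜] [NormedAddCommGroup E]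
    [InnerProductSpace 𝕜 E] [FiniteDimensional 𝕜 E] [NormedAddCommGroup F]
    [InnerProductSpace 𝕜 F] [FiniteDimensional 𝕜 F] (c : 𝕜) (T : E →ₗ[𝕜] F) (i : ℕ) :
    (c • T).singularValues i = ‖c‖ * T.singularValues i := by
  rcases le_or_gt (Module.finrank 𝕜 E) i with hi | hi
  · rw [singularValues_of_finrank_le _ hi, singularValues_of_finrank_le _ hi, mul_zero]
  have hS := T.isSymmetric_adjoint_comp_self
  have hS' := (c • T).isSymmetric_adjoint_comp_self
  have hSS : ∀ x, (adjoint (c • T) ∘ₗ (c • T)) x =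
      ((‖c‖ ^ 2 : ℝ) : 𝕜) • (adjoint T ∘ₗ T) x := by
    intro x
    refine ext_inner_right 𝕜 fun y => ?_
    simp only [coe_comp, Function.comp_apply, inner_smul_left, adjoint_inner_left, smul_apply,
      inner_smul_right]
    rw [← mul_assoc, RCLike.mul_conj]
    simp
  have hroots : (adjoint (c • T) ∘ₗ (c • T)).charpoly.roots =
      Multiset.map (fun j => ((‖c‖ ^ 2 * hS.eigenvalues rfl j : ℝ) : 𝕜)) Finset.univ.val := by
    have hmat : LinearMap.toMatrix (hS.eigenvectorBasis rfl).toBasis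
        (hS.eigenvectorBasis rfl).toBasis (adjoint (c • T) ∘ₗ (c • T)) =
        Matrix.diagonal fun j => ((‖c‖ ^ 2 * hS.eigenvalues rfl j : ℝ) : 𝕜) := by
      ext a b
      rw [LinearMap.toMatrix_apply, hSS, OrthonormalBasis.coe_toBasis, hS.apply_eigenvectorBasis]
      simp [Matrix.diagonal_apply, RCLike.real_smul_eq_coe_mul]
      grind
    rw [← LinearMap.charpoly_toMatrix _ (hS.eigenvectorBasis rfl).toBasis, hmat,
      Matrix.charpoly_diagonal, Polynomial.roots_prod _ _
      (Finset.prod_ne_zero_iff.2 fun _ _ => Polynomial.X_sub_C_ne_zero _)]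
    simp only [Polynomial.roots_X_sub_C, Multiset.bind_singleton]
  have hlist : List.ofFn (hS'.eigenvalues rfl) =
      List.ofFn fun j => ‖c‖ ^ 2 * hS.eigenvalues rfl j := by
    rw [← hS'.sort_roots_charpoly_eq_eigenvalues rfl, hroots]
    simp_rw [Fin.univ_val_map, Multiset.map_coe, List.map_ofFn,
      Function.comp_def, RCLike.ofReal_re, Multiset.coe_sort]
    refine List.mergeSort_of_pairwise ?_
    simp_rw [decide_eq_true_eq, ← List.sortedGE_iff_pairwise]
    have hanti : Antitone fun j => ‖c‖ ^ 2 * hS.eigenvalues rfl j := fun a b h =>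
      mul_le_mul_of_nonneg_left (hS.eigenvalues_antitone rfl h) (by positivity)
    exact hanti.sortedGE_ofFn
  have heig : ∀ j, hS'.eigenvalues rfl j = ‖c‖ ^ 2 * hS.eigenvalues rfl j :=
    congrFun (List.ofFn_inj.1 hlist)
  rw [singularValues_of_lt _ rfl hi, singularValues_of_lt _ rfl hi, heig,
    Real.sqrt_mul (by positivity), Real.sqrt_sq (norm_nonneg c)]

noncomputable section

namespace CondGeometry

/-! ### Geodesics and self-convex functions on a Riemannian manifold -/

section Geodesics

variable {E : Type*} [NormedAddCommGroup E] [NormedSpace ℝ E]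
  {M : Type*} [TopologicalSpace M] [ChartedSpace E M]

/-- The expression `G` of a field `g` of bilinear forms on the tangent spaces in the preferred chart
`φ` at `x₀`: `G u (v, w) = g (Dφ⁻¹(u) v, Dφ⁻¹(u) w)`, taken at the point `φ⁻¹ u`. -/
def coordForm (g : ∀ x : M, TangentSpace 𝓘(ℝ, E) x →L[ℝ] TangentSpace 𝓘(ℝ, E) x →L[ℝ] ℝ)
    (x₀ : M) (u : E) : E →L[ℝ] E →L[ℝ] ℝ :=
  let B : E →L[ℝ] E →L[ℝ] ℝ := g ((extChartAt 𝓘(ℝ, E) x₀).symm u)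
  let D : E →L[ℝ] E := mfderiv 𝓘(ℝ, E) 𝓘(ℝ, E) (extChartAt 𝓘(ℝ, E) x₀).symm u
  B.bilinearComp D D

/-- `γ` is a geodesic of the metric `g` on the interval `J`: it is of class `C²` and its covariant
acceleration vanishes at every `t ∈ J`. With `c` and `G` the expressions of `γ` and `g` in the
preferred chart at `γ t` and with `v = c'(t)`, `a = c''(t)`, `u = c(t)`, this is the equation
`G u (a, w) + DG(u)[v](v, w) - (1/2) DG(u)[w](v, v) = 0` for every `w`, that is
`aᵏ + Γᵏᵢⱼ vⁱ vʲ = 0`, with the index `k` lowered. The equation is tensorial, so it does not depend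
on the chart. At an end point of `J` that belongs to `J`, derivatives are one-sided. -/
structure IsGeodesicOn
    (g : ∀ x : M, TangentSpace 𝓘(ℝ, E) x →L[ℝ] TangentSpace 𝓘(ℝ, E) x →L[ℝ] ℝ)
    (γ : ℝ → M) (J : Set ℝ) : Prop where
  contMDiffOn : ContMDiffOn 𝓘(ℝ, ℝ) 𝓘(ℝ, E) 2 γ J
  equation : ∀ t ∈ J, ∀ w : E,
    let c : ℝ → E := fun s => extChartAt 𝓘(ℝ, E) (γ t) (γ s)
    let G : E → E →L[ℝ] E →L[ℝ] ℝ := coordForm g (γ t)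
    let u : E := c t
    let v : E := derivWithin c J t
    let a : E := derivWithin (derivWithin c J) J t
    G u a w + fderiv ℝ G u v v w - (1 / 2) * fderiv ℝ G u w v v = 0

variable [IsManifold 𝓘(ℝ, E) ∞ M]

/-- The condition metric `α ⟨·, ·⟩` associated with a function `α` on a Riemannian manifold. -/
def conditionMetric
    (g : Bundle.ContMDiffRiemannianMetric 𝓘(ℝ, E) ∞ E (fun x : M => TangentSpace 𝓘(ℝ, E) x))
    (α : M → ℝ) (x : M) : TangentSpace 𝓘(ℝ, E) x →L[ℝ] TangentSpace 𝓘(ℝ, E) x →L[ℝ] ℝ :=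
  α x • g.inner x

/-- `α` is self-convex on the open subset `U` of the Riemannian manifold `(M, g)`: it is of class
`C²` and positive on `U`, and `log (α (γ t))` is a convex function of `t` for every geodesic `γ` in
`U` of the condition metric `α g`. -/
structure IsSelfConvexOn
    (g : Bundle.ContMDiffRiemannianMetric 𝓘(ℝ, E) ∞ E (fun x : M => TangentSpace 𝓘(ℝ, E) x))
    (α : M → ℝ) (U : Set M) : Prop where
  isOpen : IsOpen U
  contMDiffOn : ContMDiffOn 𝓘(ℝ, E) 𝓘(ℝ, ℝ) 2 α U
  pos : ∀ x ∈ U, 0 < α x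
  convexOn_log : ∀ (J : Set ℝ) (γ : ℝ → M), J.OrdConnected → Set.MapsTo γ J U →
    IsGeodesicOn (conditionMetric g α) γ J → ConvexOn ℝ J (fun t => Real.log (α (γ t)))

end Geodesics

/-! ### Projective space as a Riemannian manifold

For a Hermitian (or Euclidean) space `V`, the projective space `ℙ 𝕜 V` carries the quotient topology
and, for every unit vector `z`, the chart inverse to `u ∈ zᗮ ↦ p(z + u)`, where `p` is the canonical
surjection. The Fubini-Study metric is the one for which the restriction of `p` to the unit sphere
is a Riemannian submersion. -/

section Projective

set_option linter.unusedSectionVars false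

variable (𝕜 : Type*) [RCLike 𝕜] (V : Type*) [NormedAddCommGroup V] [InnerProductSpace 𝕜 V]
  [FiniteDimensional 𝕜 V]

/-- The space in which the charts of `ℙ 𝕜 V` take their values: it is isometric to `zᗮ` for every
unit vector `z`. -/
def ProjModel : Type _ := EuclideanSpace 𝕜 (Fin (Module.finrank 𝕜 V - 1))

instance ProjModel.instNormedAddCommGroup : NormedAddCommGroup (ProjModel 𝕜 V) :=
  inferInstanceAs (NormedAddCommGroup (EuclideanSpace 𝕜 (Fin (Module.finrank 𝕜 V - 1))))

instance ProjModel.instInnerProductSpace : InnerProductSpace 𝕜 (ProjModel 𝕜 V) :=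
  inferInstanceAs (InnerProductSpace 𝕜 (EuclideanSpace 𝕜 (Fin (Module.finrank 𝕜 V - 1))))

instance ProjModel.instNormedSpaceReal : NormedSpace ℝ (ProjModel 𝕜 V) :=
  NormedSpace.restrictScalars ℝ 𝕜 (ProjModel 𝕜 V)

instance ProjModel.instIsScalarTower : IsScalarTower ℝ 𝕜 (ProjModel 𝕜 V) :=
  ⟨fun r c v => by rw [RCLike.real_smul_eq_coe_mul, mul_smul]; rfl⟩

instance ProjModel.instFiniteDimensional : FiniteDimensional 𝕜 (ProjModel 𝕜 V) :=
  inferInstanceAs (FiniteDimensional 𝕜 (EuclideanSpace 𝕜 (Fin (Module.finrank 𝕜 V - 1))))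

instance ProjModel.instFiniteDimensionalReal : FiniteDimensional ℝ (ProjModel 𝕜 V) :=
  FiniteDimensional.trans ℝ 𝕜 (ProjModel 𝕜 V)

instance Projectivization.instTopologicalSpace : TopologicalSpace (ℙ 𝕜 V) :=
  inferInstanceAs (TopologicalSpace (Quotient (projectivizationSetoid 𝕜 V)))

variable {V}

/-- The orthogonal complement `zᗮ = {u | ⟪z, u⟫ = 0}`: the horizontal space at a unit vector `z`. -/
abbrev horizontal (z : V) : Submodule 𝕜 V := (𝕜 ∙ z)ᗮ

variable {𝕜}

theorem finrank_horizontal {z : V} (hz : ‖z‖ = 1) :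
    Module.finrank 𝕜 (horizontal 𝕜 z) = Module.finrank 𝕜 V - 1 := by
  have h := Submodule.finrank_add_finrank_orthogonal (𝕜 ∙ z)
  rw [finrank_span_singleton (by rintro rfl; simp at hz)] at h
  simp only [horizontal]
  omega

variable (𝕜) in
/-- A choice of coordinates: a `𝕜`-linear isometry from `zᗮ` to the model space. -/
def horizontalEquiv {z : V} (hz : ‖z‖ = 1) : horizontal 𝕜 z ≃ₗᵢ[𝕜] ProjModel 𝕜 V :=
  ((stdOrthonormalBasis 𝕜 (horizontal 𝕜 z)).reindex (finCongr (finrank_horizontal hz))).repr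

theorem inner_add_horizontal {z : V} (hz : ‖z‖ = 1) (u : horizontal 𝕜 z) :
    inner 𝕜 z (z + (u : V)) = 1 := by
  have : inner 𝕜 z (u : V) = 0 := Submodule.mem_orthogonal_singleton_iff_inner_right.1 u.2
  rw [inner_add_right, this, inner_self_eq_norm_sq_to_K, hz]; simp

theorem add_horizontal_ne_zero {z : V} (hz : ‖z‖ = 1) (u : horizontal 𝕜 z) : z + (u : V) ≠ 0 := by
  intro h
  have := inner_add_horizontal hz u
  rw [h, inner_zero_right] at this
  exact zero_ne_one this

/-- The parametrization `u ↦ p(z + u)` of projective space by `zᗮ`. -/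
def projParam {z : V} (hz : ‖z‖ = 1) (u : horizontal 𝕜 z) : ℙ 𝕜 V :=
  Projectivization.mk 𝕜 (z + (u : V)) (add_horizontal_ne_zero hz u)

/-- The inverse of `u ↦ p(z + u)`, on vectors: `x ↦ x / ⟪z, x⟫ - z`, which is the component of
`x / ⟪z, x⟫` in `zᗮ`. -/
def projCoordVec {z : V} (_hz : ‖z‖ = 1) (x : V) : horizontal 𝕜 z :=
  (horizontal 𝕜 z).orthogonalProjectionOnto ((inner 𝕜 z x)⁻¹ • x)

theorem projCoordVec_smul {z : V} (hz : ‖z‖ = 1) {c : 𝕜} (hc : c ≠ 0) (x : V) :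
    projCoordVec hz (c • x) = projCoordVec (𝕜 := 𝕜) hz x := by
  simp only [projCoordVec, inner_smul_right, smul_smul, mul_inv]
  congr 2
  field_simp

theorem projCoordVec_add {z : V} (hz : ‖z‖ = 1) (u : horizontal 𝕜 z) :
    projCoordVec hz (z + (u : V)) = u := by
  rw [projCoordVec, inner_add_horizontal hz, inv_one, one_smul, map_add,
    Submodule.orthogonalProjectionOnto_mem_subspace_eq_self,
    Submodule.orthogonalProjectionOnto_orthogonalComplement_singleton_eq_zero, zero_add]

theorem add_projCoordVec {z : V} (hz : ‖z‖ = 1) {x : V} (hx : inner 𝕜 z x ≠ 0) :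
    z + (projCoordVec (𝕜 := 𝕜) hz x : V) = (inner 𝕜 z x)⁻¹ • x := by
  rw [projCoordVec, Submodule.coe_orthogonalProjectionOnto_apply, Submodule.starProjection_orthogonal_val,
    Submodule.starProjection_unit_singleton 𝕜 hz, inner_smul_right, inv_mul_cancel₀ hx]
  simp

/-- The map `projCoordVec`, on projective space. -/
def projCoord {z : V} (hz : ‖z‖ = 1) (p : ℙ 𝕜 V) : horizontal 𝕜 z :=
  p.lift (fun x => projCoordVec hz (x : V)) (by
    intro a b t h
    have ht : t ≠ 0 := by rintro rfl; exact a.2 (by simpa using h)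
    simp only [h]
    exact projCoordVec_smul hz ht b)

theorem isOpen_inner_ne (z : V) : IsOpen {x : {v : V // v ≠ 0} | inner 𝕜 z (x : V) ≠ 0} := by
  refine isOpen_ne.preimage (f := fun x : {v : V // v ≠ 0} => inner 𝕜 z (x : V)) ?_
  fun_prop

variable (𝕜) in
/-- The points of projective space that are not orthogonal to `z`. -/
def chartDomain (z : V) : Set (ℙ 𝕜 V) := {p | inner 𝕜 z p.rep ≠ 0}

theorem mk_mem_chartDomain {z x : V} (hx : x ≠ 0) :
    Projectivization.mk 𝕜 x hx ∈ chartDomain 𝕜 z ↔ inner 𝕜 z x ≠ 0 := by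
  obtain ⟨a, ha⟩ := Projectivization.exists_smul_eq_mk_rep 𝕜 x hx
  simp [chartDomain, ← ha, Units.smul_def, inner_smul_right]

theorem isOpen_chartDomain (z : V) : IsOpen (chartDomain 𝕜 z) := by
  refine isOpen_coinduced.2 ?_
  convert isOpen_inner_ne (𝕜 := 𝕜) z using 1
  ext ⟨x, hx⟩
  exact mk_mem_chartDomain hx

theorem isQuotientMap_mk' : Topology.IsQuotientMap (Projectivization.mk' 𝕜 : {v : V // v ≠ 0} → ℙ 𝕜 V) :=
  isQuotientMap_quot_mk

theorem continuousOn_projCoordVec {z : V} (hz : ‖z‖ = 1) :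
    ContinuousOn (projCoordVec (𝕜 := 𝕜) hz) {x | inner 𝕜 z x ≠ 0} := by
  unfold projCoordVec
  refine (ContinuousLinearMap.continuous _).comp_continuousOn ?_
  refine ContinuousOn.smul (ContinuousOn.inv₀ (by fun_prop) fun x hx => hx) continuousOn_id

variable (𝕜) in
/-- The chart of projective space at `p(z)`, the inverse of `u ↦ p(z + u)`. -/
def projChart {z : V} (hz : ‖z‖ = 1) : OpenPartialHomeomorph (ℙ 𝕜 V) (ProjModel 𝕜 V) where
  toFun p := horizontalEquiv 𝕜 hz (projCoord hz p)
  invFun u := projParam hz ((horizontalEquiv 𝕜 hz).symm u)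
  source := chartDomain 𝕜 z
  target := Set.univ
  map_source' _ _ := Set.mem_univ _
  map_target' u _ := by
    simp only [projParam]
    rw [mk_mem_chartDomain, inner_add_horizontal hz]
    exact one_ne_zero
  left_inv' := by
    intro p hp
    induction p with
    | h x hx =>
      rw [mk_mem_chartDomain] at hp
      simp only [LinearIsometryEquiv.symm_apply_apply, projParam]
      rw [Projectivization.mk_eq_mk_iff']
      exact ⟨(inner 𝕜 z x)⁻¹, (add_projCoordVec hz hp).symm⟩
  right_inv' := by
    intro u _
    exact (congrArg (horizontalEquiv 𝕜 hz) (projCoordVec_add hz _)).trans (by simp)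
  open_source := isOpen_chartDomain z
  open_target := isOpen_univ
  continuousOn_toFun := by
    refine (LinearIsometryEquiv.continuous _).comp_continuousOn ?_
    rw [isQuotientMap_mk'.continuousOn_isOpen_iff (isOpen_chartDomain z)]
    refine (continuousOn_projCoordVec (𝕜 := 𝕜) hz).comp continuous_subtype_val.continuousOn ?_
    rintro ⟨x, hx⟩ h
    exact (mk_mem_chartDomain hx).1 h
  continuousOn_invFun := by
    refine Continuous.continuousOn ?_
    have : Continuous fun u : ProjModel 𝕜 V =>
        (⟨z + ((horizontalEquiv 𝕜 hz).symm u : V), add_horizontal_ne_zero hz _⟩ : {v : V // v ≠ 0}) := by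
      refine Continuous.subtype_mk ?_ _
      fun_prop
    exact isQuotientMap_mk'.continuous.comp this

/-- A unit vector that represents the point `p`. -/
def unitRep (p : ℙ 𝕜 V) : V := ((‖p.rep‖⁻¹ : ℝ) : 𝕜) • p.rep

theorem norm_unitRep (p : ℙ 𝕜 V) : ‖unitRep p‖ = 1 := by
  simp only [unitRep]
  rw [norm_smul, RCLike.norm_ofReal, abs_of_nonneg (by positivity)]
  exact inv_mul_cancel₀ (norm_ne_zero_iff.2 p.rep_nonzero)

theorem unitRep_ne_zero (p : ℙ 𝕜 V) : unitRep p ≠ 0 := by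
  rw [← norm_ne_zero_iff, norm_unitRep]; exact one_ne_zero

theorem mk_unitRep (p : ℙ 𝕜 V) : Projectivization.mk 𝕜 (unitRep p) (unitRep_ne_zero p) = p := by
  conv_rhs => rw [← p.mk_rep]
  rw [Projectivization.mk_eq_mk_iff']
  exact ⟨_, rfl⟩

instance Projectivization.instChartedSpace : ChartedSpace (ProjModel 𝕜 V) (ℙ 𝕜 V) where
  atlas := {e | ∃ (z : V) (hz : ‖z‖ = 1), e = projChart 𝕜 hz}
  chartAt p := projChart 𝕜 (norm_unitRep p)
  mem_chart_source p := by
    show p ∈ chartDomain 𝕜 (unitRep p)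
    refine Eq.mp (congrArg (· ∈ chartDomain 𝕜 (unitRep p)) (mk_unitRep p)) ?_
    rw [mk_mem_chartDomain, inner_self_eq_norm_sq_to_K, norm_unitRep]
    simp
  chart_mem_atlas p := ⟨_, norm_unitRep p, rfl⟩

theorem projChart_comp_symm {z w : V} (hz : ‖z‖ = 1) (hw : ‖w‖ = 1) (u : ProjModel 𝕜 V) :
    projChart 𝕜 hw ((projChart 𝕜 hz).symm u) =
      horizontalEquiv 𝕜 hw (projCoordVec hw (z + ((horizontalEquiv 𝕜 hz).symm u : V))) := rfl

theorem projChart_symm_mem {z w : V} (hz : ‖z‖ = 1) (hw : ‖w‖ = 1) (u : ProjModel 𝕜 V) :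
    (projChart 𝕜 hz).symm u ∈ (projChart 𝕜 hw).source ↔
      inner 𝕜 w (z + ((horizontalEquiv 𝕜 hz).symm u : V)) ≠ 0 :=
  mk_mem_chartDomain _

theorem contDiffOn_projCoordVec {z : V} (hz : ‖z‖ = 1) {n : WithTop ℕ∞} :
    ContDiffOn 𝕜 n (projCoordVec (𝕜 := 𝕜) hz) {x | inner 𝕜 z x ≠ 0} := by
  unfold projCoordVec
  refine (ContinuousLinearMap.contDiff _).comp_contDiffOn ?_
  refine ContDiffOn.smul (ContDiffOn.inv ?_ fun x hx => hx) contDiffOn_id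
  exact (innerSL 𝕜 z).contDiff.contDiffOn

instance Projectivization.instIsManifold {n : WithTop ℕ∞} :
    IsManifold 𝓘(ℝ, ProjModel 𝕜 V) n (ℙ 𝕜 V) := by
  refine isManifold_of_contDiffOn _ _ _ ?_
  rintro _ _ ⟨z, hz, rfl⟩ ⟨w, hw, rfl⟩
  simp only [modelWithCornersSelf_coe, modelWithCornersSelf_coe_symm, Function.comp_id,
    Function.id_comp, Set.preimage_id, Set.range_id, Set.inter_univ]
  have : ContDiffOn 𝕜 n (fun u => horizontalEquiv 𝕜 hw (projCoordVec hw
      (z + ((horizontalEquiv 𝕜 hz).symm u : V)))) ((projChart 𝕜 hz).symm.trans (projChart 𝕜 hw)).source := by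
    refine (LinearIsometryEquiv.contDiff _).comp_contDiffOn ?_
    refine (contDiffOn_projCoordVec hw).comp ?_ ?_
    · refine ContDiff.contDiffOn (contDiff_const.add ?_)
      exact (horizontal 𝕜 z).subtypeL.contDiff.comp (LinearIsometryEquiv.contDiff _)
    · intro u hu
      rw [OpenPartialHomeomorph.trans_source] at hu
      exact (projChart_symm_mem hz hw u).1 hu.2
  exact this.restrict_scalars ℝ


theorem hasFDerivAt_projCoordVec {z x : V} (hz : ‖z‖ = 1) (hx : inner 𝕜 z x ≠ 0) :
    HasFDerivAt (projCoordVec (𝕜 := 𝕜) hz)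
      ((horizontal 𝕜 z).orthogonalProjectionOnto ∘L
        ((inner 𝕜 z x)⁻¹ • ContinuousLinearMap.id 𝕜 V +
          (-((inner 𝕜 z x) ^ 2)⁻¹ • innerSL 𝕜 z).smulRight x)) x := by
  have h1 : HasFDerivAt (fun y => inner 𝕜 z y) (innerSL 𝕜 z) x := (innerSL 𝕜 z).hasFDerivAt
  have h2 : HasFDerivAt (fun y => (inner 𝕜 z y)⁻¹) (-((inner 𝕜 z x) ^ 2)⁻¹ • innerSL 𝕜 z) x :=
    (hasDerivAt_inv hx).comp_hasFDerivAt x h1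
  exact (ContinuousLinearMap.hasFDerivAt _).comp x (h2.smul (hasFDerivAt_id x))

/-- The Fubini-Study inner product of two tangent vectors at `p`: the real part of the Hermitian
product of their horizontal lifts at a unit vector `z` representing `p`. A tangent vector at `p` is
given by its coordinates in the preferred chart at `p`, the inverse of `u ∈ zᗮ ↦ p(z + u)`, whose
differential at `0` is that of `p` at `z`. See `fubiniStudy_submersion` for the independence of the
choices. -/
def fubiniStudyForm (p : ℙ 𝕜 V) :
    TangentSpace 𝓘(ℝ, ProjModel 𝕜 V) p →L[ℝ] TangentSpace 𝓘(ℝ, ProjModel 𝕜 V) p →L[ℝ] ℝ :=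
  let L : ProjModel 𝕜 V → V := fun v => ((horizontalEquiv 𝕜 (norm_unitRep p)).symm v : V)
  have hL : ∀ (c : ℝ) (v : ProjModel 𝕜 V), L (c • v) = (c : 𝕜) • L v := fun c v => by
    simp only [L]
    rw [RCLike.real_smul_eq_coe_smul (K := 𝕜) c v, map_smul, Submodule.coe_smul]
  LinearMap.mkContinuous₂ (E := ProjModel 𝕜 V) (F := ProjModel 𝕜 V)
    (LinearMap.mk₂ ℝ (fun v w => RCLike.re (inner 𝕜 (L v) (L w)))
      (fun v v' w => by simp [L, inner_add_left])
      (fun c v w => by rw [hL]; simp [inner_smul_left])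
      (fun v w w' => by simp [L, inner_add_right])
      (fun c v w => by rw [hL]; simp [inner_smul_right]))
    1 (fun v w => by
      have hn : ∀ v : ProjModel 𝕜 V, ‖L v‖ = ‖v‖ := fun v =>
        (Submodule.coe_norm _).symm.trans (LinearIsometryEquiv.norm_map _ v)
      have h := (RCLike.abs_re_le_norm _).trans (norm_inner_le_norm (𝕜 := 𝕜) (L v) (L w))
      rw [hn, hn] at h
      rw [one_mul]
      exact h)

theorem fubiniStudyForm_apply (p : ℙ 𝕜 V) (v w : ProjModel 𝕜 V) :
    fubiniStudyForm p v w = RCLike.re (inner 𝕜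
      ((horizontalEquiv 𝕜 (norm_unitRep p)).symm v : V)
      ((horizontalEquiv 𝕜 (norm_unitRep p)).symm w : V)) := rfl

theorem fubiniStudyForm_eq (p : ℙ 𝕜 V) (v w : ProjModel 𝕜 V) :
    fubiniStudyForm p v w = RCLike.re (inner 𝕜 v w) := by
  rw [fubiniStudyForm_apply, ← Submodule.coe_inner, LinearIsometryEquiv.inner_map_map]


section Real

variable [NormedSpace ℝ V] [IsScalarTower ℝ 𝕜 V] {N : Type*} [NormedAddCommGroup N]
  [NormedSpace ℝ N]

theorem unitRep_spec {x : V} (hx : x ≠ 0) :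
    inner 𝕜 (unitRep (Projectivization.mk 𝕜 x hx)) x • unitRep (Projectivization.mk 𝕜 x hx) = x ∧
    ‖inner 𝕜 (unitRep (Projectivization.mk 𝕜 x hx)) x‖ = ‖x‖ := by
  set p := Projectivization.mk 𝕜 x hx with hp
  obtain ⟨a, ha⟩ := (Projectivization.mk_eq_mk_iff' 𝕜 x (unitRep p) hx (unitRep_ne_zero p)).1
    (mk_unitRep p).symm
  have h : inner 𝕜 (unitRep p) x = a := by
    rw [← ha, inner_smul_right, inner_self_eq_norm_sq_to_K, norm_unitRep]; simp
  rw [h]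
  refine ⟨ha, ?_⟩
  rw [← ha, norm_smul, norm_unitRep, mul_one]

theorem continuousAt_mk {X : N → V} (hX : ∀ y, X y ≠ 0) {y : N} (h : ContinuousAt X y) :
    ContinuousAt (fun y => Projectivization.mk 𝕜 (X y) (hX y)) y := by
  have : ContinuousAt (fun y => (⟨X y, hX y⟩ : {v : V // v ≠ 0})) y :=
    Topology.IsInducing.subtypeVal.continuousAt_iff.2 h
  exact (isQuotientMap_mk' (𝕜 := 𝕜)).continuous.continuousAt.comp this

theorem hasMFDerivAt_mk {X : N → V} (hX : ∀ y, X y ≠ 0) {y : N} {X' : N →L[ℝ] V}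
    (h : HasFDerivAt X X' y) :
    HasMFDerivAt 𝓘(ℝ, N) 𝓘(ℝ, ProjModel 𝕜 V) (fun y => Projectivization.mk 𝕜 (X y) (hX y)) y
      (((((horizontalEquiv 𝕜 (norm_unitRep (Projectivization.mk 𝕜 (X y) (hX y)))).toContinuousLinearEquiv :
        _ →L[𝕜] ProjModel 𝕜 V) ∘L
        ((horizontal 𝕜 (unitRep (Projectivization.mk 𝕜 (X y) (hX y)))).orthogonalProjectionOnto ∘L
        ((inner 𝕜 (unitRep (Projectivization.mk 𝕜 (X y) (hX y))) (X y))⁻¹ •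
            ContinuousLinearMap.id 𝕜 V +
          (-((inner 𝕜 (unitRep (Projectivization.mk 𝕜 (X y) (hX y))) (X y)) ^ 2)⁻¹ •
            innerSL 𝕜 (unitRep (Projectivization.mk 𝕜 (X y) (hX y)))).smulRight (X y)))
          ).restrictScalars ℝ) ∘L X') := by
  refine ⟨continuousAt_mk hX h.continuousAt, ?_⟩
  simp only [mfld_simps]
  have hne : inner 𝕜 (unitRep (Projectivization.mk 𝕜 (X y) (hX y))) (X y) ≠ 0 := by
    rw [← norm_ne_zero_iff, (unitRep_spec (hX y)).2]
    exact norm_ne_zero_iff.2 (hX y)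
  have h1 := hasFDerivAt_projCoordVec (𝕜 := 𝕜)
    (norm_unitRep (Projectivization.mk 𝕜 (X y) (hX y))) hne
  have h2 := ((horizontalEquiv 𝕜 (norm_unitRep (Projectivization.mk 𝕜 (X y)
    (hX y)))).toContinuousLinearEquiv.hasFDerivAt.comp (X y) h1).restrictScalars ℝ
  exact (h2.comp y h).hasFDerivWithinAt

theorem fubiniStudyForm_mfderiv_mk {X : N → V} (hX : ∀ y, X y ≠ 0) {y : N} {X' : N →L[ℝ] V}
    (h : HasFDerivAt X X' y) (a b : N) :
    fubiniStudyForm (Projectivization.mk 𝕜 (X y) (hX y))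
      (mfderiv 𝓘(ℝ, N) 𝓘(ℝ, ProjModel 𝕜 V) (fun y => Projectivization.mk 𝕜 (X y) (hX y)) y a)
      (mfderiv 𝓘(ℝ, N) 𝓘(ℝ, ProjModel 𝕜 V) (fun y => Projectivization.mk 𝕜 (X y) (hX y)) y b) =
    RCLike.re (inner 𝕜 (X' a) (X' b)) / ‖X y‖ ^ 2 -
      RCLike.re (inner 𝕜 (X' a) (X y) * inner 𝕜 (X y) (X' b)) / ‖X y‖ ^ 4 := by
  rw [(hasMFDerivAt_mk (𝕜 := 𝕜) hX h).mfderiv]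
  refine (fubiniStudyForm_apply _ _ _).trans ?_
  obtain ⟨h1, h2⟩ := unitRep_spec (𝕜 := 𝕜) (hX y)
  set w := unitRep (Projectivization.mk 𝕜 (X y) (hX y)) with hw
  set c := inner 𝕜 w (X y) with hc
  have hwn : ‖w‖ = 1 := norm_unitRep _
  have hxn : ‖X y‖ ≠ 0 := norm_ne_zero_iff.2 (hX y)
  have hP : ∀ A : V, (horizontal 𝕜 w).orthogonalProjectionOnto
      (c⁻¹ • A + (-(c ^ 2)⁻¹ * inner 𝕜 w A) • X y) =
      c⁻¹ • (horizontal 𝕜 w).orthogonalProjectionOnto A := by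
    intro A
    rw [map_add, map_smul, map_smul, ← h1, map_smul,
      Submodule.orthogonalProjectionOnto_orthogonalComplement_singleton_eq_zero]
    simp
  have hval : ∀ A : V, ((horizontal 𝕜 w).orthogonalProjectionOnto A : V) =
      A - inner 𝕜 w A • w := by
    intro A
    rw [Submodule.coe_orthogonalProjectionOnto_apply, Submodule.starProjection_orthogonal_val,
      Submodule.starProjection_unit_singleton 𝕜 hwn]
  have hD : ∀ a : N, ((horizontalEquiv 𝕜 hwn).symm
      ((horizontalEquiv 𝕜 hwn) ((horizontal 𝕜 w).orthogonalProjectionOnto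
      (c⁻¹ • (X' a) + (-(c ^ 2)⁻¹ * inner 𝕜 w (X' a)) • X y))) : V) =
      c⁻¹ • (X' a - inner 𝕜 w (X' a) • w) := by
    intro a
    rw [LinearIsometryEquiv.symm_apply_apply, hP, Submodule.coe_smul, hval]
  have key : RCLike.re (inner 𝕜 (c⁻¹ • (X' a - inner 𝕜 w (X' a) • w))
      (c⁻¹ • (X' b - inner 𝕜 w (X' b) • w))) = RCLike.re (inner 𝕜 (X' a) (X' b)) / ‖X y‖ ^ 2 -
      RCLike.re (inner 𝕜 (X' a) (X y) * inner 𝕜 (X y) (X' b)) / ‖X y‖ ^ 4 := by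
    have e1 : inner 𝕜 (c⁻¹ • (X' a - inner 𝕜 w (X' a) • w)) (c⁻¹ • (X' b - inner 𝕜 w (X' b) • w))
        = (((‖X y‖ ^ 2)⁻¹ : ℝ) : 𝕜) *
          (inner 𝕜 (X' a) (X' b) - inner 𝕜 (X' a) w * inner 𝕜 w (X' b)) := by
      rw [inner_smul_left, inner_smul_right, ← mul_assoc, RCLike.conj_mul, norm_inv, h2]
      congr 1
      · push_cast; rw [inv_pow]
      · simp only [inner_sub_left, inner_sub_right, inner_smul_left, inner_smul_right,
          inner_conj_symm, inner_self_eq_norm_sq_to_K, hwn]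
        simp
    have e2 : inner 𝕜 (X' a) (X y) * inner 𝕜 (X y) (X' b) =
        ((‖X y‖ ^ 2 : ℝ) : 𝕜) * (inner 𝕜 (X' a) w * inner 𝕜 w (X' b)) := by
      rw [← h1, inner_smul_left, inner_smul_right, h1, ← h2]
      push_cast
      rw [← RCLike.conj_mul]
      ring
    rw [e1, e2, RCLike.re_ofReal_mul, RCLike.re_ofReal_mul, map_sub]
    field_simp
  rw [← key, ← hD a, ← hD b]
  simp only [hw]
  rfl

end Real


/-- The Fubini-Study metric in the preferred chart at `p`. -/
theorem fubiniStudyForm_chart (p : ℙ 𝕜 V) (u a b : ProjModel 𝕜 V) :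
    fubiniStudyForm ((extChartAt 𝓘(ℝ, ProjModel 𝕜 V) p).symm u)
      (mfderiv 𝓘(ℝ, ProjModel 𝕜 V) 𝓘(ℝ, ProjModel 𝕜 V)
        (extChartAt 𝓘(ℝ, ProjModel 𝕜 V) p).symm u a)
      (mfderiv 𝓘(ℝ, ProjModel 𝕜 V) 𝓘(ℝ, ProjModel 𝕜 V)
        (extChartAt 𝓘(ℝ, ProjModel 𝕜 V) p).symm u b) =
    RCLike.re (inner 𝕜 a b) / (1 + ‖u‖ ^ 2) -
      RCLike.re (inner 𝕜 a u * inner 𝕜 u b) / (1 + ‖u‖ ^ 2) ^ 2 := by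
  let _ : NormedSpace ℝ V := NormedSpace.restrictScalars ℝ 𝕜 V
  have : IsScalarTower ℝ 𝕜 V := ⟨fun r c v => by
    rw [RCLike.real_smul_eq_coe_mul, mul_smul]; rfl⟩
  have hz := norm_unitRep p
  let b' := horizontalEquiv 𝕜 hz
  let X' : ProjModel 𝕜 V →L[ℝ] V := ((horizontal 𝕜 (unitRep p)).subtypeL ∘L
    (b'.symm.toContinuousLinearEquiv : ProjModel 𝕜 V →L[𝕜] _)).restrictScalars ℝ
  have hX : HasFDerivAt (fun u : ProjModel 𝕜 V => unitRep p + (b'.symm u : V)) X' u :=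
    X'.hasFDerivAt.const_add _
  have key := fubiniStudyForm_mfderiv_mk (𝕜 := 𝕜)
    (fun u : ProjModel 𝕜 V => add_horizontal_ne_zero hz (b'.symm u)) hX a b
  refine Eq.trans ?_ (key.trans ?_)
  · simp only [mfld_simps]
    rfl
  · have hperp : ∀ v : ProjModel 𝕜 V, inner 𝕜 (unitRep p) (b'.symm v : V) = 0 := fun v =>
      Submodule.mem_orthogonal_singleton_iff_inner_right.1 (b'.symm v).2
    have hperp' : ∀ v : ProjModel 𝕜 V, inner 𝕜 (b'.symm v : V) (unitRep p) = 0 := fun v =>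
      Submodule.mem_orthogonal_singleton_iff_inner_left.1 (b'.symm v).2
    have hin : ∀ v w : ProjModel 𝕜 V, inner 𝕜 (b'.symm v : V) (b'.symm w : V) = inner 𝕜 v w :=
      fun v w => (Submodule.coe_inner _ _ _).symm.trans (b'.symm.inner_map_map v w)
    have hn : ‖unitRep p + (b'.symm u : V)‖ ^ 2 = 1 + ‖u‖ ^ 2 := by
      have h := norm_add_sq_eq_norm_sq_add_norm_sq_of_inner_eq_zero (𝕜 := 𝕜) _ _ (hperp u)
      rw [hz] at h
      have h' : ‖(b'.symm u : V)‖ = ‖u‖ := (Submodule.coe_norm _).symm.trans (b'.symm.norm_map u)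
      rw [h'] at h
      nlinarith [h]
    have hX'v : ∀ v, X' v = (b'.symm v : V) := fun v => rfl
    rw [show ‖unitRep p + (b'.symm u : V)‖ ^ 4 = (‖unitRep p + (b'.symm u : V)‖ ^ 2) ^ 2 by ring,
      hn, hX'v, hX'v, inner_add_left, inner_add_right, hperp, hperp', hin, hin, hin, zero_add,
      zero_add]

open Bundle in
theorem contMDiff_fubiniStudyForm :
    ContMDiff 𝓘(ℝ, ProjModel 𝕜 V)
      (𝓘(ℝ, ProjModel 𝕜 V).prod 𝓘(ℝ, ProjModel 𝕜 V →L[ℝ] ProjModel 𝕜 V →L[ℝ] ℝ)) ∞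
      (fun p : ℙ 𝕜 V => TotalSpace.mk' (ProjModel 𝕜 V →L[ℝ] ProjModel 𝕜 V →L[ℝ] ℝ)
        (E := fun p : ℙ 𝕜 V => TangentSpace 𝓘(ℝ, ProjModel 𝕜 V) p →L[ℝ]
          TangentSpace 𝓘(ℝ, ProjModel 𝕜 V) p →L[ℝ] ℝ) p (fubiniStudyForm p)) := by
  intro p
  rw [contMDiffAt_hom_bundle]
  refine ⟨contMDiffAt_id, ?_⟩
  set f : ℙ 𝕜 V → ProjModel 𝕜 V →L[ℝ] ProjModel 𝕜 V →L[ℝ] ℝ := fun x =>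
    ContinuousLinearMap.inCoordinates (ProjModel 𝕜 V) (TangentSpace 𝓘(ℝ, ProjModel 𝕜 V))
      (ProjModel 𝕜 V →L[ℝ] ℝ) (fun x => TangentSpace 𝓘(ℝ, ProjModel 𝕜 V) x →L[ℝ] ℝ) p x p x
      (fubiniStudyForm x) with hf
  change ContMDiffAt _ _ _ f p
  let φ := extChartAt 𝓘(ℝ, ProjModel 𝕜 V) p
  have hQ : ContDiff ℝ ∞ (f ∘ φ.symm) := by
    rw [contDiff_clm_apply_iff]
    intro a
    rw [contDiff_clm_apply_iff]
    intro b
    have heq : (fun u => (f ∘ φ.symm) u a b) = fun u =>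
        RCLike.re (inner 𝕜 a b) / (1 + ‖u‖ ^ 2) -
      RCLike.re (inner 𝕜 a u * inner 𝕜 u b) / (1 + ‖u‖ ^ 2) ^ 2 := by
      funext u
      rw [← fubiniStudyForm_chart p u a b]
      have hmem : φ.symm u ∈ (chartAt (ProjModel 𝕜 V) p).source := by
        have := φ.map_target (x := u) (by simp [φ, extChartAt]; exact Set.mem_univ _)
        simpa [φ] using this
      have hu : φ (φ.symm u) = u := φ.right_inv (by simp [φ, extChartAt]; exact Set.mem_univ _)
      simp only [hf, Function.comp_apply]
      rw [inCoordinates_apply_eq₂ (by simpa using hmem) (by simpa using hmem) (by simp)]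
      have hsymm : ∀ v : ProjModel 𝕜 V,
          (trivializationAt (ProjModel 𝕜 V) (TangentSpace 𝓘(ℝ, ProjModel 𝕜 V)) p).symm (φ.symm u) v =
          mfderiv 𝓘(ℝ, ProjModel 𝕜 V) 𝓘(ℝ, ProjModel 𝕜 V) φ.symm u v := by
        intro v
        have h := TangentBundle.symmL_trivializationAt (I := 𝓘(ℝ, ProjModel 𝕜 V)) hmem
        have h' := DFunLike.congr_fun h v
        rw [Bundle.Trivialization.symmL_apply (hb := by simpa using hmem)] at h'
        refine h'.trans ?_
        change mfderivWithin 𝓘(ℝ, ProjModel 𝕜 V) 𝓘(ℝ, ProjModel 𝕜 V) φ.symm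
          (Set.range 𝓘(ℝ, ProjModel 𝕜 V)) (φ (φ.symm u)) v = _
        rw [hu, modelWithCornersSelf_coe, Set.range_id, mfderivWithin_univ]
      rw [hsymm, hsymm]
      simp
      rfl
    rw [heq]
    have hne : ∀ u : ProjModel 𝕜 V, 1 + ‖u‖ ^ 2 ≠ 0 := fun u => by positivity
    have h1 : ContDiff ℝ ∞ fun u : ProjModel 𝕜 V => 1 + ‖u‖ ^ 2 :=
      contDiff_const.add (contDiff_norm_sq 𝕜)
    have h2 : ContDiff ℝ ∞ fun u : ProjModel 𝕜 V => RCLike.re (inner 𝕜 a u * inner 𝕜 u b) :=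
      RCLike.reCLM.contDiff.comp
        ((contDiff_const.inner 𝕜 contDiff_id).mul (contDiff_id.inner 𝕜 contDiff_const))
    exact (contDiff_const.div h1 hne).sub (h2.div (h1.pow 2) fun u => pow_ne_zero 2 (hne u))
  have hcomp : ContMDiffAt 𝓘(ℝ, ProjModel 𝕜 V)
      𝓘(ℝ, ProjModel 𝕜 V →L[ℝ] ProjModel 𝕜 V →L[ℝ] ℝ) ∞ ((f ∘ φ.symm) ∘ φ) p :=
    hQ.contMDiff.contMDiffAt.comp p contMDiffAt_extChartAt
  refine hcomp.congr_of_eventuallyEq ?_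
  filter_upwards [extChartAt_source_mem_nhds (I := 𝓘(ℝ, ProjModel 𝕜 V)) p] with x hx
  simp only [Function.comp_apply]
  rw [φ.left_inv hx]


variable (𝕜 V) in
/-- The Fubini-Study metric, a smooth Riemannian metric on `ℙ 𝕜 V`. -/
def fubiniStudy : Bundle.ContMDiffRiemannianMetric 𝓘(ℝ, ProjModel 𝕜 V) ∞ (ProjModel 𝕜 V)
    (fun p : ℙ 𝕜 V => TangentSpace 𝓘(ℝ, ProjModel 𝕜 V) p) where
  inner := fubiniStudyForm
  symm p v w := by
    refine (fubiniStudyForm_eq p v w).trans (Eq.trans ?_ (fubiniStudyForm_eq p w v).symm)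
    exact inner_re_symm (𝕜 := 𝕜) (E := ProjModel 𝕜 V) v w
  pos p v hv := by
    refine lt_of_lt_of_eq ?_ (fubiniStudyForm_eq p v v).symm
    rw [← norm_sq_eq_re_inner (𝕜 := 𝕜) (E := ProjModel 𝕜 V) v]
    exact pow_pos (norm_pos_iff.2 hv) 2
  isVonNBounded p := by
    have h : {v : ProjModel 𝕜 V | fubiniStudyForm p v v < 1} ⊆ Metric.ball 0 1 := by
      intro v hv
      rw [Set.mem_ofPred_eq, fubiniStudyForm_eq, ← norm_sq_eq_re_inner] at hv
      rw [mem_ball_zero_iff]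
      nlinarith [norm_nonneg v]
    exact (NormedSpace.isVonNBounded_ball ℝ (ProjModel 𝕜 V) 1).subset h
  contMDiff := contMDiff_fubiniStudyForm

/-- The property that characterizes the Fubini-Study metric: for every unit vector `z`, the
differential at `z` of the canonical surjection is an isometry from `zᗮ`, with the real part of the
Hermitian product, to the tangent space at `p(z)`. -/
theorem fubiniStudy_submersion [NormedSpace ℝ V] [IsScalarTower ℝ 𝕜 V] {z : V} (hz : ‖z‖ = 1)
    (u v : horizontal 𝕜 z) :
    (fubiniStudy 𝕜 V).inner (projParam hz 0)
      (mfderiv 𝓘(ℝ, horizontal 𝕜 z) 𝓘(ℝ, ProjModel 𝕜 V) (projParam hz) 0 u)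
      (mfderiv 𝓘(ℝ, horizontal 𝕜 z) 𝓘(ℝ, ProjModel 𝕜 V) (projParam hz) 0 v) =
    RCLike.re (inner 𝕜 (u : V) (v : V)) := by
  let X' : horizontal 𝕜 z →L[ℝ] V := ((horizontal 𝕜 z).subtypeL).restrictScalars ℝ
  have hX : HasFDerivAt (fun u : horizontal 𝕜 z => z + (u : V)) X' 0 :=
    X'.hasFDerivAt.const_add _
  have hu : inner 𝕜 (u : V) z = 0 := Submodule.mem_orthogonal_singleton_iff_inner_left.1 u.2
  have key := fubiniStudyForm_mfderiv_mk (𝕜 := 𝕜) (add_horizontal_ne_zero hz) hX u v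
  refine key.trans ?_
  simp [hz, X', hu]

end Projective

/-! ### Matrices, singular values and the condition number -/

section Matrices

variable {𝕜 : Type*} [RCLike 𝕜] {n m : ℕ}

variable (𝕜 n m) in
/-- The space `𝕜^{n×m}` of `n × m` matrices with the Frobenius Hermitian product and norm. -/
abbrev MatrixSpace : Type _ := EuclideanSpace 𝕜 (Fin n × Fin m)

/-- An element of `𝕜^{n×m}` as a matrix. -/
def toMatrix (A : MatrixSpace 𝕜 n m) : Matrix (Fin n) (Fin m) 𝕜 := Matrix.of fun i j => A (i, j)

/-- The singular values of `A` in non-increasing order, counted from `0`: `singVal A k` is the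
`(k + 1)`-st largest one, so the smallest of the `n ≤ m` singular values `σ₁ ≥ ⋯ ≥ σₙ` is
`singVal A (n - 1)`. -/
def singVal (A : MatrixSpace 𝕜 n m) (k : ℕ) : ℝ := (toMatrix A).toEuclideanLin.singularValues k

/-- The set `GL^>_{n,m}`: the smallest singular value is positive, so that `A` has rank `n`, and
simple, that is, smaller than all the others. -/
def IsGLgt (A : MatrixSpace 𝕜 n m) : Prop :=
  0 < singVal A (n - 1) ∧ ∀ i, i < n - 1 → singVal A (n - 1) < singVal A i

theorem singVal_smul (c : 𝕜) (A : MatrixSpace 𝕜 n m) (k : ℕ) :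
    singVal (c • A) k = ‖c‖ * singVal A k := by
  have h : (toMatrix (c • A)).toEuclideanLin = c • (toMatrix A).toEuclideanLin := by
    rw [← map_smul]; rfl
  rw [singVal, singVal, h, LinearMap.singularValues_smul]

/-- The square of the condition number on projective space: `‖A‖_F² σₙ(A)⁻²` at the class of `A`. -/
def condNumberSq : ℙ 𝕜 (MatrixSpace 𝕜 n m) → ℝ :=
  Projectivization.lift
    (fun A => ‖(A : MatrixSpace 𝕜 n m)‖ ^ 2 * (singVal (A : MatrixSpace 𝕜 n m) (n - 1) ^ 2)⁻¹) (by
      intro a b t h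
      have ht : ‖t‖ ≠ 0 := by
        intro h0
        exact a.2 (by rw [h, norm_eq_zero.1 h0, zero_smul])
      simp only [h, norm_smul, singVal_smul, mul_pow, mul_inv]
      field_simp)

variable (𝕜 n m) in
/-- The image `ℙ(GL^>_{n,m})` of `GL^>_{n,m}` in projective space. -/
def projGLgt : Set (ℙ 𝕜 (MatrixSpace 𝕜 n m)) :=
  {p | ∃ (A : MatrixSpace 𝕜 n m) (hA : A ≠ 0), IsGLgt A ∧ Projectivization.mk 𝕜 A hA = p}

end Matrices

end CondGeometry

end

/-! Fix a point $p$ with unit representative $z$, and let $x$ be a unit left singular vector of $z$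
for $\sigma_n$. The map $S:y\mapsto(x_iy_j)$ is a linear isometry of $\mathbb K^m$ into $V$. Its
adjoint $R$ satisfies $\|R B\|=\|B^*x\|\ge\sigma_n(B)$ for every $B$, with equality at $z$
(`exists_isometry_singVal`). So $\|B\|^2/\|R B\|^2$ is a barrier: it lies below $\alpha_2$ and
touches it at $p$. Along a curve through $p$, the second derivative of $\log\alpha_2$ is therefore
at least that of the logarithm of the barrier (`deriv_deriv_le_of_eventually_le`), and this one is
explicit because $R$ is linear.

The curve is a geodesic for $\alpha_2$, not for the barrier, but the two functions have the same
differential at $p$ (`fderiv_chartRatio_apply`), and the geodesic equation sees $\alpha_2$ only to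
first order. In the chart centred at $p$ the first derivatives of the Fubini–Study coefficients
vanish, so that equation involves only $d\alpha_2$ (`IsGeodesicOn.equation_conditionMetric`). Let
$v$ and $a$ be the lifted velocity and acceleration and put $F=\sigma_n(z)^2$. Testing the equation
against the horizontal part of $SRz$ gives $\operatorname{Re}\langle Rz,Ra\rangle$, and the second
derivative of the barrier becomes $2(\|v\|^2-\|Rv\|^2)/F\ge 0$, since $\|R\|\le 1$
(`deriv_deriv_log_nonneg`).

Simplicity of $\sigma_n>0$ serves regularity: $\sigma_n^2$ is then a simple root of the
characteristic polynomial of $A^*A$, hence smooth by the implicit function theorem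
(`contDiffAt_singVal_sq`). Openness follows from the continuity of singular values, a consequence of
the max-min principle. -/

open Filter Topology

/-! ### Max-min principle and continuity of singular values -/

namespace LinearMap

variable {𝕜 E F : Type*} [RCLike 𝕜] [NormedAddCommGroup E]
    [InnerProductSpace 𝕜 E] [FiniteDimensional 𝕜 E] [NormedAddCommGroup F]
    [InnerProductSpace 𝕜 F] [FiniteDimensional 𝕜 F] (T : E →ₗ[𝕜] F)

/-- An orthonormal basis of right singular vectors. -/
noncomputable def rightSingularBasis :
    OrthonormalBasis (Fin (Module.finrank 𝕜 E)) 𝕜 E :=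
  T.isSymmetric_adjoint_comp_self.eigenvectorBasis rfl

theorem adjoint_apply_rightSingularBasis (i : Fin (Module.finrank 𝕜 E)) :
    adjoint T (T (T.rightSingularBasis i)) =
      ((T.singularValues i ^ 2 : ℝ) : 𝕜) • T.rightSingularBasis i := by
  rw [T.sq_singularValues_fin rfl]
  exact T.isSymmetric_adjoint_comp_self.apply_eigenvectorBasis rfl i

theorem norm_sq_apply_eq_sum (x : E) :
    ‖T x‖ ^ 2 = ∑ i : Fin (Module.finrank 𝕜 E),
      T.singularValues i ^ 2 * ‖inner 𝕜 (T.rightSingularBasis i) x‖ ^ 2 := by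
  have h : inner 𝕜 (T x) (T x) = ((∑ i : Fin (Module.finrank 𝕜 E),
      T.singularValues i ^ 2 * ‖inner 𝕜 (T.rightSingularBasis i) x‖ ^ 2 : ℝ) : 𝕜) := by
    rw [← adjoint_inner_left, ← T.rightSingularBasis.sum_inner_mul_inner]
    push_cast
    refine Finset.sum_congr rfl fun i _ => ?_
    rw [adjoint_inner_left, ← adjoint_inner_right, adjoint_apply_rightSingularBasis,
      inner_smul_right, mul_assoc, ← inner_conj_symm x, RCLike.conj_mul]
    push_cast
    rfl
  rw [inner_self_eq_norm_sq_to_K] at h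
  exact_mod_cast h

/-- A dimension count: a subspace of dimension greater than `k` meets the orthogonal complement of
the first `k` right singular vectors, where `‖T x‖` is at most the `k`-th singular value times
`‖x‖`. This is one half of the max-min principle. -/
theorem le_singularValues_of_le_norm {k : ℕ} {c : ℝ} {S : Submodule 𝕜 E}
    (hS : k < Module.finrank 𝕜 S) (h : ∀ x ∈ S, c * ‖x‖ ≤ ‖T x‖) : c ≤ T.singularValues k := by
  rcases le_or_gt c 0 with hc | hc
  · exact hc.trans (T.singularValues_nonneg k)
  set b := T.rightSingularBasis
  let U : Submodule 𝕜 E := Submodule.span 𝕜 (Set.range fun i : {i : Fin (Module.finrank 𝕜 E) // (i : ℕ) < k} => b i)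
  have hU : Module.finrank 𝕜 U ≤ k := by
    refine (finrank_range_le_card _).trans ?_
    refine (Fintype.card_le_of_injective (β := Fin k) (fun i => ⟨i.1, i.2⟩) ?_).trans
      (Fintype.card_fin k).le
    rintro ⟨i, _⟩ ⟨j, _⟩ hij
    simpa [Fin.ext_iff] using hij
  have hdim := Submodule.finrank_add_finrank_orthogonal U
  have hne : S ⊓ Uᗮ ≠ ⊥ := by
    intro hbot
    have := Submodule.finrank_sup_add_finrank_inf_eq S Uᗮ
    rw [hbot, finrank_bot] at this
    have := Submodule.finrank_le (S ⊔ Uᗮ)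
    omega
  obtain ⟨x, hx, hx0⟩ := Submodule.exists_mem_ne_zero_of_ne_bot hne
  have hle : ‖T x‖ ^ 2 ≤ (T.singularValues k * ‖x‖) ^ 2 := by
    rw [T.norm_sq_apply_eq_sum, mul_pow, ← b.sum_sq_norm_inner_right x, Finset.mul_sum]
    refine Finset.sum_le_sum fun i _ => ?_
    rcases lt_or_ge (i : ℕ) k with hi | hi
    · have : inner 𝕜 (b i) x = 0 :=
        (Submodule.mem_orthogonal _ _).1 hx.2 _ (Submodule.subset_span ⟨⟨i, hi⟩, rfl⟩)
      simp [b] at this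
      simp [this, b]
    · have h1 := T.singularValues_antitone hi
      have h2 := T.singularValues_nonneg i
      gcongr
  have h1 := h x hx.1
  have h2 : ‖T x‖ ≤ T.singularValues k * ‖x‖ :=
    (pow_le_pow_iff_left₀ (norm_nonneg _) (mul_nonneg (T.singularValues_nonneg k) (norm_nonneg x))
      two_ne_zero).1 hle
  exact le_of_mul_le_mul_right (h1.trans h2) (norm_pos_iff.2 hx0)

/-- The other half of the max-min principle: the span of the right singular vectors with indices `0,
…, k` attains the maximum. -/
theorem exists_submodule_singularValues_mul_norm_le {k : ℕ} (hk : k < Module.finrank 𝕜 E) :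
    ∃ S : Submodule 𝕜 E, Module.finrank 𝕜 S = k + 1 ∧
      ∀ x ∈ S, T.singularValues k * ‖x‖ ≤ ‖T x‖ := by
  set b := T.rightSingularBasis
  let v : Fin (k + 1) → E := fun i => b (Fin.castLE hk i)
  have hv : LinearIndependent 𝕜 v :=
    b.orthonormal.linearIndependent.comp _ (Fin.castLE_injective hk)
  refine ⟨Submodule.span 𝕜 (Set.range v), by simpa using finrank_span_eq_card hv, fun x hx => ?_⟩
  refine (pow_le_pow_iff_left₀ (mul_nonneg (T.singularValues_nonneg k) (norm_nonneg x))
      (norm_nonneg _) two_ne_zero).1 ?_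
  rw [T.norm_sq_apply_eq_sum, mul_pow, ← b.sum_sq_norm_inner_right x, Finset.mul_sum]
  refine Finset.sum_le_sum fun i _ => ?_
  rcases lt_or_ge k (i : ℕ) with hi | hi
  · have : inner 𝕜 (b i) x = 0 := by
      induction hx using Submodule.span_induction with
      | mem y hy =>
        obtain ⟨j, rfl⟩ := hy
        refine b.inner_eq_zero fun h => ?_
        have := congrArg Fin.val h
        simp at this
        omega
      | zero => simp
      | add y z _ _ hy hz => rw [inner_add_right, hy, hz, add_zero]
      | smul c y _ hy => rw [inner_smul_right, hy, mul_zero]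
    simp [b] at this
    simp [this, b]
  · have h1 := T.singularValues_antitone hi
    have h2 := T.singularValues_nonneg k
    gcongr

/-- Weyl's perturbation bound: the optimal subspace for `T` is a competitor for `T'`, with a loss of
at most `c`. -/
theorem singularValues_le_add {T T' : E →ₗ[𝕜] F} {c : ℝ} (hc : ∀ x, ‖T x - T' x‖ ≤ c * ‖x‖)
    (hc0 : 0 ≤ c) (k : ℕ) : T.singularValues k ≤ T'.singularValues k + c := by
  rcases le_or_gt (Module.finrank 𝕜 E) k with hk | hk
  · simpa [singularValues_of_finrank_le _ hk] using hc0
  obtain ⟨S, hS, h⟩ := T.exists_submodule_singularValues_mul_norm_le hk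
  rw [← sub_le_iff_le_add]
  refine T'.le_singularValues_of_le_norm (S := S) (by omega) fun x hx => ?_
  have h1 := h x hx
  have h2 := hc x
  have h3 := norm_sub_norm_le (T x) (T' x)
  linarith

theorem continuous_singularValues (k : ℕ) :
    Continuous fun T : E →L[𝕜] F => (T : E →ₗ[𝕜] F).singularValues k := by
  refine (LipschitzWith.of_dist_le_mul (K := 1) fun T T' => ?_).continuous
  rw [NNReal.coe_one, one_mul, Real.dist_eq, abs_sub_le_iff, sub_le_iff_le_add',
    sub_le_iff_le_add', dist_eq_norm]
  constructor
  · refine singularValues_le_add (fun x => ?_) (norm_nonneg _) k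
    exact (T - T').le_opNorm x
  · refine singularValues_le_add (fun x => ?_) (norm_nonneg _) k
    rw [norm_sub_rev T]
    exact (T' - T).le_opNorm x

/-- If this singular value is positive, `T` maps a subspace of dimension `finrank 𝕜 F` bijectively
onto `F`. A preimage `y` of `x` there has norm at most `‖x‖` over the singular value, and `‖x‖² =
⟪T* x, y⟫`. The adjoint is needed because `T` itself has a kernel when its source is larger than
`F`. -/
theorem singularValues_mul_norm_le_norm_adjoint (x : F) :
    T.singularValues (Module.finrank 𝕜 F - 1) * ‖x‖ ≤ ‖adjoint T x‖ := by
  set k := Module.finrank 𝕜 F - 1 with hk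
  rcases eq_or_ne x 0 with rfl | hx
  · simp
  -- Without this the truncated subtraction would spoil `k + 1 = finrank 𝕜 F`.
  have hF : 0 < Module.finrank 𝕜 F := by
    have : Nontrivial F := ⟨x, 0, hx⟩
    exact Module.finrank_pos
  rcases (T.singularValues_nonneg k).eq_or_lt with h0 | h0
  · simp [← h0]
  have hkE : k < Module.finrank 𝕜 E := by
    by_contra! h
    exact h0.ne' (T.singularValues_of_finrank_le h)
  obtain ⟨S, hS, h⟩ := T.exists_submodule_singularValues_mul_norm_le hkE
  have hinj : Function.Injective (T.domRestrict S) := by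
    rw [← ker_eq_bot, ker_eq_bot']
    intro y hy
    have h1 := h y y.2
    have h2 : T (y : E) = 0 := hy
    rw [h2, norm_zero] at h1
    have h3 : ‖(y : E)‖ ≤ 0 := by
      by_contra! h3
      exact (mul_pos h0 h3).not_ge h1
    simpa using h3
  obtain ⟨y, hy⟩ := (injective_iff_surjective_of_finrank_eq_finrank (by omega)).1 hinj x
  have hy' : T (y : E) = x := hy
  have h1 := h y y.2
  rw [hy'] at h1
  have h2 : ‖x‖ ^ 2 ≤ ‖adjoint T x‖ * ‖(y : E)‖ := by
    have := norm_inner_le_norm (𝕜 := 𝕜) (adjoint T x) (y : E)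
    rw [adjoint_inner_left, hy', inner_self_eq_norm_sq_to_K] at this
    simpa using this
  have h3 : 0 < ‖x‖ := norm_pos_iff.2 hx
  have h4 : T.singularValues k * ‖x‖ ^ 2 ≤ ‖adjoint T x‖ * ‖x‖ := by
    nlinarith [norm_nonneg (adjoint T x)]
  nlinarith

/-- The witness is the left singular vector `T v / σ`, with `v` the `k`-th right singular vector. -/
theorem exists_norm_adjoint_eq_singularValues {k : ℕ} (hk : 0 < T.singularValues k) :
    ∃ x : F, ‖x‖ = 1 ∧ ‖adjoint T x‖ = T.singularValues k := by
  have hkE : k < Module.finrank 𝕜 E := by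
    by_contra! h
    exact hk.ne' (T.singularValues_of_finrank_le h)
  set v := T.rightSingularBasis ⟨k, hkE⟩ with hv
  have hvn : ‖v‖ = 1 := T.rightSingularBasis.norm_eq_one _
  have h1 : adjoint T (T v) = ((T.singularValues k ^ 2 : ℝ) : 𝕜) • v :=
    T.adjoint_apply_rightSingularBasis ⟨k, hkE⟩
  have h2 : ‖T v‖ = T.singularValues k := by
    have : inner 𝕜 (T v) (T v) = ((T.singularValues k ^ 2 : ℝ) : 𝕜) := by
      rw [← adjoint_inner_right, h1, inner_smul_right, inner_self_eq_norm_sq_to_K, hvn]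
      simp
    rw [inner_self_eq_norm_sq_to_K] at this
    exact (pow_left_inj₀ (norm_nonneg _) hk.le two_ne_zero).1 (by exact_mod_cast this)
  have h3 : ‖(((T.singularValues k)⁻¹ : ℝ) : 𝕜)‖ = (T.singularValues k)⁻¹ := by
    rw [RCLike.norm_ofReal, abs_of_pos (inv_pos.2 hk)]
  refine ⟨(((T.singularValues k)⁻¹ : ℝ) : 𝕜) • T v, ?_, ?_⟩
  · rw [norm_smul, h3, h2, inv_mul_cancel₀ hk.ne']
  · rw [map_smul, norm_smul, h3, h1, norm_smul, hvn, RCLike.norm_ofReal, abs_of_pos (by positivity)]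
    field_simp

end LinearMap

/-! ### Smoothness of a simple smallest singular value, and the touching isometry -/

/-- A function which is implicitly defined by a smooth equation and continuous at a point is smooth
at that point. -/
theorem ContDiffAt.of_implicit {E G : Type*} [NormedAddCommGroup E] [NormedSpace ℝ E]
    [CompleteSpace E] [NormedAddCommGroup G] [NormedSpace ℝ G] [CompleteSpace G] {F : E × G → G}
    {n : WithTop ℕ∞} (hn : n ≠ 0) {y : E → G} {x₀ : E} (hF : ContDiffAt ℝ n F (x₀, y x₀))
    (hy : ContinuousAt y x₀) (h0 : ∀ x, F (x, y x) = 0)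
    (hinv : (fderiv ℝ F (x₀, y x₀) ∘L .inr ℝ E G).IsInvertible) : ContDiffAt ℝ n y x₀ := by
  refine (hF.contDiffAt_implicitFunction hn hinv).congr_of_eventuallyEq ?_
  have h1 := hF.eventually_apply_eq_iff_implicitFunction hn hinv
  -- Continuity of `y` keeps its graph in the neighbourhood where the zero set of `F` is the graph
  -- of the implicit function.
  have h2 : Tendsto (fun x => (x, y x)) (𝓝 x₀) (𝓝 (x₀, y x₀)) := continuousAt_id.prodMk hy
  filter_upwards [h2.eventually h1] with x hx
  exact (hx.1 (by rw [h0, h0])).symm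

namespace CondGeometry

variable {𝕜 : Type*} [RCLike 𝕜] {n m : ℕ}

/-- The linear map with matrix `A`, as a linear function of `A`. -/
noncomputable def toEuclideanMap :
    MatrixSpace 𝕜 n m →ₗ[𝕜] EuclideanSpace 𝕜 (Fin m) →L[𝕜] EuclideanSpace 𝕜 (Fin n) where
  toFun A := LinearMap.toContinuousLinearMap (toMatrix A).toEuclideanLin
  map_add' A B := by
    rw [← map_add, ← map_add]; rfl
  map_smul' c A := by
    rw [RingHom.id_apply, ← map_smul, ← map_smul]; rfl

theorem singVal_eq (A : MatrixSpace 𝕜 n m) (k : ℕ) :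
    singVal A k =
      (toEuclideanMap A : EuclideanSpace 𝕜 (Fin m) →ₗ[𝕜] EuclideanSpace 𝕜 (Fin n)).singularValues k :=
  rfl

theorem singVal_nonneg (A : MatrixSpace 𝕜 n m) (k : ℕ) : 0 ≤ singVal A k :=
  LinearMap.singularValues_nonneg _ k

theorem continuous_singVal (k : ℕ) : Continuous fun A : MatrixSpace 𝕜 n m => singVal A k := by
  have h : Continuous (toEuclideanMap (𝕜 := 𝕜) (n := n) (m := m)) :=
    LinearMap.continuous_of_finiteDimensional _
  simp_rw [singVal_eq]
  exact Continuous.comp (LinearMap.continuous_singularValues (𝕜 := 𝕜)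
    (E := EuclideanSpace 𝕜 (Fin m)) (F := EuclideanSpace 𝕜 (Fin n)) k) h

theorem isOpen_setOf_isGLgt : IsOpen {A : MatrixSpace 𝕜 n m | IsGLgt A} := by
  have h : {A : MatrixSpace 𝕜 n m | IsGLgt A} = {A | 0 < singVal A (n - 1)} ∩
      ⋂ i ∈ Finset.range (n - 1), {A | singVal A (n - 1) < singVal A i} := by
    ext A
    simp [IsGLgt]
  rw [h]
  refine (isOpen_lt continuous_const (continuous_singVal _)).inter ?_
  exact isOpen_biInter_finset fun i _ => isOpen_lt (continuous_singVal _) (continuous_singVal _)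

theorem isGLgt_smul {c : 𝕜} (hc : c ≠ 0) {A : MatrixSpace 𝕜 n m} (hA : IsGLgt A) :
    IsGLgt (c • A) := by
  have hc' : 0 < ‖c‖ := norm_pos_iff.2 hc
  simp only [IsGLgt, singVal_smul]
  exact ⟨mul_pos hc' hA.1, fun i hi => mul_lt_mul_of_pos_left (hA.2 i hi) hc'⟩

/-- The characteristic polynomial of `AᴴA`, evaluated at `t`. -/
noncomputable def gramCharpoly (p : MatrixSpace 𝕜 n m × 𝕜) : 𝕜 :=
  (((toMatrix p.1).conjTranspose * toMatrix p.1).charpoly).eval p.2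

theorem gramCharpoly_eq_det (p : MatrixSpace 𝕜 n m × 𝕜) :
    gramCharpoly p =
      (Matrix.scalar (Fin m) p.2 - (toMatrix p.1).conjTranspose * toMatrix p.1).det := by
  rw [gramCharpoly, Matrix.charpoly, ← Polynomial.coe_evalRingHom, RingHom.map_det]
  congr 1
  ext i j
  by_cases h : i = j
  · subst h; simp
  · simp [h]

/-- The determinant is a polynomial in `t`, the entries of `A` and their conjugates; conjugation is
only real-linear, hence smoothness over `ℝ`. -/
theorem contDiff_gramCharpoly :
    ContDiff ℝ ∞ (gramCharpoly : MatrixSpace 𝕜 n m × 𝕜 → 𝕜) := by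
  have : (gramCharpoly : MatrixSpace 𝕜 n m × 𝕜 → 𝕜) = fun p =>
      (Matrix.scalar (Fin m) p.2 - (toMatrix p.1).conjTranspose * toMatrix p.1).det :=
    funext gramCharpoly_eq_det
  rw [this]
  have hentry : ∀ i j, ContDiff ℝ ∞ fun p : MatrixSpace 𝕜 n m × 𝕜 =>
      (Matrix.scalar (Fin m) p.2 - (toMatrix p.1).conjTranspose * toMatrix p.1) i j := by
    intro i j
    have h1 : ContDiff ℝ ∞ fun p : MatrixSpace 𝕜 n m × 𝕜 => Matrix.scalar (Fin m) p.2 i j := by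
      by_cases h : i = j
      · subst h; simpa using contDiff_snd
      · simpa [h] using contDiff_const
    have hA : ∀ k : Fin n × Fin m, ContDiff ℝ ∞ fun p : MatrixSpace 𝕜 n m × 𝕜 => p.1 k := by
      intro k
      exact ((EuclideanSpace.proj (𝕜 := 𝕜) k).contDiff.restrict_scalars ℝ).comp contDiff_fst
    refine h1.sub ?_
    simp only [Matrix.mul_apply]
    refine ContDiff.sum fun k _ => ContDiff.mul ?_ (hA (k, j))
    exact ((starL' ℝ (A := 𝕜) : 𝕜 ≃L[ℝ] 𝕜).contDiff).comp (hA (k, i))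
  simp only [Matrix.det_apply]
  refine ContDiff.sum fun σ _ => ContDiff.const_smul _ ?_
  exact contDiff_prod fun i _ => hentry _ _

/-- Equality of multisets, so that multiplicities of roots can be read from coincidences among
singular values. The index runs over all of `Fin m`; from `n` on the values are zero. -/
theorem gram_charpoly_roots (A : MatrixSpace 𝕜 n m) :
    (((toMatrix A).conjTranspose * toMatrix A).charpoly).roots =
      Multiset.map (fun i : Fin m => ((singVal A i ^ 2 : ℝ) : 𝕜)) Finset.univ.val := by
  have hS := LinearMap.isSymmetric_adjoint_comp_self (toMatrix A).toEuclideanLin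
  have h := hS.roots_charpoly_eq_eigenvalues (n := m) (by simp)
  have h2 : LinearMap.adjoint (toMatrix A).toEuclideanLin ∘ₗ (toMatrix A).toEuclideanLin =
      Matrix.toLin (EuclideanSpace.basisFun (Fin m) 𝕜).toBasis
        (EuclideanSpace.basisFun (Fin m) 𝕜).toBasis ((toMatrix A).conjTranspose * toMatrix A) := by
    rw [Matrix.toLin_mul _ (EuclideanSpace.basisFun (Fin n) 𝕜).toBasis,
      ← Matrix.toEuclideanLin_conjTranspose_eq_adjoint]
    rfl
  have h3 : (LinearMap.adjoint (toMatrix A).toEuclideanLin ∘ₗ (toMatrix A).toEuclideanLin).charpoly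
      = ((toMatrix A).conjTranspose * toMatrix A).charpoly := by
    rw [h2, Matrix.charpoly_toLin]
  rw [← h3, h]
  congr 1
  funext i
  rw [singVal, LinearMap.sq_singularValues_fin _ (by simp)]
  rfl

theorem gramCharpoly_singVal {k : ℕ} (hk : k < m) (A : MatrixSpace 𝕜 n m) :
    gramCharpoly (A, ((singVal A k ^ 2 : ℝ) : 𝕜)) = 0 := by
  have : ((singVal A k ^ 2 : ℝ) : 𝕜) ∈ (((toMatrix A).conjTranspose * toMatrix A).charpoly).roots := by
    rw [gram_charpoly_roots]
    exact Multiset.mem_map.2 ⟨⟨k, hk⟩, by simp, rfl⟩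
  exact (Polynomial.mem_roots'.1 this).2

/-- Before `n - 1` this is simplicity; after it the singular values vanish because the rank is at
most `n`, so positivity separates them. -/
theorem singVal_ne_of_isGLgt {A : MatrixSpace 𝕜 n m} (hn : 1 ≤ n) (hA : IsGLgt A) {i : ℕ}
    (hi : i ≠ n - 1) : singVal A i ≠ singVal A (n - 1) := by
  rcases lt_or_gt_of_ne hi with h | h
  · exact (hA.2 i h).ne'
  · have : singVal A i = 0 := by
      refine (LinearMap.singularValues_eq_zero_iff_le_finrank_range _).2 ?_
      refine (Submodule.finrank_le _).trans ?_
      rw [finrank_euclideanSpace_fin]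
      omega
    rw [this]
    exact hA.1.ne

/-- A vanishing derivative would make the root multiple, hence give two indices with the same
singular value. -/
theorem derivative_gram_charpoly_ne_zero {A : MatrixSpace 𝕜 n m} (hn : 1 ≤ n) (hnm : n ≤ m)
    (hA : IsGLgt A) : ((((toMatrix A).conjTranspose * toMatrix A).charpoly).derivative).eval
      ((singVal A (n - 1) ^ 2 : ℝ) : 𝕜) ≠ 0 := by
  intro h
  have hne : ((toMatrix A).conjTranspose * toMatrix A).charpoly ≠ 0 :=
    (Matrix.charpoly_monic _).ne_zero
  have h1 := (Polynomial.one_lt_rootMultiplicity_iff_isRoot hne).2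
    ⟨gramCharpoly_singVal (by omega) A, h⟩
  rw [← Polynomial.count_roots, gram_charpoly_roots, Multiset.count_map] at h1
  refine absurd h1 (not_lt.2 (Finset.card_le_one (s := Finset.univ.filter fun i : Fin m =>
    ((singVal A (n - 1) ^ 2 : ℝ) : 𝕜) = ((singVal A i ^ 2 : ℝ) : 𝕜)).2 ?_))
  have hval : ∀ i ∈ Finset.univ.filter fun i : Fin m =>
      ((singVal A (n - 1) ^ 2 : ℝ) : 𝕜) = ((singVal A i ^ 2 : ℝ) : 𝕜), (i : ℕ) = n - 1 := by
    intro i hi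
    by_contra hne
    have h2 := RCLike.ofReal_inj.1 (Finset.mem_filter.1 hi).2
    exact singVal_ne_of_isGLgt hn hA hne
      ((pow_left_inj₀ (singVal_nonneg _ _) (singVal_nonneg _ _) two_ne_zero).1 h2).symm
  exact fun i hi j hj => Fin.ext ((hval i hi).trans (hval j hj).symm)

theorem contDiffAt_singVal_sq {A : MatrixSpace 𝕜 n m} (hn : 1 ≤ n) (hnm : n ≤ m)
    (hA : IsGLgt A) : ContDiffAt ℝ ∞ (fun B : MatrixSpace 𝕜 n m => singVal B (n - 1) ^ 2) A := by
  have hk : n - 1 < m := by omega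
  have key : ContDiffAt ℝ ∞
      (fun B : MatrixSpace 𝕜 n m => ((singVal B (n - 1) ^ 2 : ℝ) : 𝕜)) A := by
    refine ContDiffAt.of_implicit (F := gramCharpoly) (by simp) contDiff_gramCharpoly.contDiffAt ?_
      (gramCharpoly_singVal hk) ?_
    · exact (RCLike.continuous_ofReal.comp ((continuous_singVal _).pow 2)).continuousAt
    -- The partial derivative in the second variable is multiplication by `d`, a real-linear
    -- isomorphism of `𝕜` since `d ≠ 0`.
    · set t : 𝕜 := ((singVal A (n - 1) ^ 2 : ℝ) : 𝕜) with ht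
      set d := (((toMatrix A).conjTranspose * toMatrix A).charpoly).derivative.eval t with hd
      have hd0 : d ≠ 0 := derivative_gram_charpoly_ne_zero hn hnm hA
      have h1 : HasFDerivAt (fun s : 𝕜 => gramCharpoly (A, s))
          (fderiv ℝ gramCharpoly (A, t) ∘L .inr ℝ (MatrixSpace 𝕜 n m) 𝕜) t :=
        ((contDiff_gramCharpoly.differentiable (by simp)) (A, t)).hasFDerivAt.comp t
          (hasFDerivAt_prodMk_right A t)
      let e : 𝕜 ≃L[ℝ] 𝕜 :=
        (ContinuousLinearEquiv.unitsEquivAut 𝕜 (Units.mk0 d hd0)).restrictScalars ℝ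
      have h2 : HasFDerivAt (fun s : 𝕜 => gramCharpoly (A, s)) (e : 𝕜 →L[ℝ] 𝕜) t := by
        have h3 := ((((toMatrix A).conjTranspose * toMatrix A).charpoly).hasDerivAt
          t).hasFDerivAt.restrictScalars ℝ
        refine h3.congr_fderiv ?_
        ext s
        simp [e, hd]
      rw [h1.unique h2]
      exact ⟨e, rfl⟩
  have h := RCLike.reCLM.contDiff.contDiffAt.comp A key
  refine h.congr_of_eventuallyEq (Eventually.of_forall fun B => ?_)
  exact (RCLike.ofReal_re (K := 𝕜) _).symm

/-- With `x` a unit left singular vector of `A`, take `S y = (x i * y j)`. Its adjoint sends `B` to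
the row `x* B`, whose norm is that of `B* x`. This bounds the smallest singular value from above by
the norm of a linear map, with equality at `A`. -/
theorem exists_isometry_singVal {A : MatrixSpace 𝕜 n m} (hA : 0 < singVal A (n - 1)) :
    ∃ S : EuclideanSpace 𝕜 (Fin m) →ₗᵢ[𝕜] MatrixSpace 𝕜 n m,
      (∀ B, singVal B (n - 1) ≤ ‖S.toContinuousLinearMap.adjoint B‖) ∧
      ‖S.toContinuousLinearMap.adjoint A‖ = singVal A (n - 1) := by
  obtain ⟨x, hx, hxA⟩ := LinearMap.exists_norm_adjoint_eq_singularValues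
    (T := (toMatrix A).toEuclideanLin) hA
  let S : EuclideanSpace 𝕜 (Fin m) →ₗᵢ[𝕜] MatrixSpace 𝕜 n m :=
    { toFun y := WithLp.toLp 2 fun k => x k.1 * y k.2
      map_add' y z := by ext k; simp [mul_add]
      map_smul' c y := by ext k; simp; ring
      norm_map' y := by
        refine (pow_left_inj₀ (norm_nonneg _) (norm_nonneg _) two_ne_zero).1 ?_
        have h1 : ∑ i, ‖x i‖ ^ 2 = 1 := by rw [← EuclideanSpace.norm_sq_eq, hx, one_pow]
        rw [EuclideanSpace.norm_sq_eq, EuclideanSpace.norm_sq_eq, Fintype.sum_prod_type]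
        simp only [LinearMap.coe_mk, AddHom.coe_mk, norm_mul, mul_pow]
        simp_rw [← Finset.mul_sum]
        rw [← Finset.sum_mul, h1, one_mul] }
  have hS : ∀ B, ‖S.toContinuousLinearMap.adjoint B‖ =
      ‖LinearMap.adjoint (toMatrix B).toEuclideanLin x‖ := by
    intro B
    rw [EuclideanSpace.norm_eq, EuclideanSpace.norm_eq]
    congr 1
    refine Finset.sum_congr rfl fun j _ => ?_
    have h1 : S.toContinuousLinearMap.adjoint B j = ∑ i, star (x i) * B (i, j) := by
      have h2 := EuclideanSpace.inner_single_left (𝕜 := 𝕜) j 1 (S.toContinuousLinearMap.adjoint B)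
      rw [ContinuousLinearMap.adjoint_inner_right, map_one, one_mul] at h2
      rw [← h2, PiLp.inner_apply, Fintype.sum_prod_type]
      refine Finset.sum_congr rfl fun i _ => ?_
      rw [Finset.sum_eq_single j]
      · simp [S, mul_comm]
      · intro j' _ hj
        simp [S, hj]
      · simp
    have h2 : LinearMap.adjoint (toMatrix B).toEuclideanLin x j = ∑ i, star (B (i, j)) * x i := by
      rw [← Matrix.toEuclideanLin_conjTranspose_eq_adjoint]
      rfl
    -- The two coordinates are conjugate to each other, so only their norms agree.
    rw [h1, h2, ← norm_star, star_sum]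
    simp [mul_comm]
  refine ⟨S, fun B => ?_, ?_⟩
  · have h := LinearMap.singularValues_mul_norm_le_norm_adjoint (toMatrix B).toEuclideanLin x
    rw [finrank_euclideanSpace_fin, hx, mul_one] at h
    rw [hS]
    exact h
  · rw [hS]
    exact hxA

end CondGeometry

/-! ### Comparison of second derivatives and derivatives of `log ‖X‖²` -/

section SecondDerivative

theorem ContDiffAt.eventually_hasDerivAt {E : Type*} [NormedAddCommGroup E] [NormedSpace ℝ E]
    {g : ℝ → E} {t : ℝ} (hg : ContDiffAt ℝ 2 g t) :
    (∀ᶠ s in 𝓝 t, HasDerivAt g (deriv g s) s) ∧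
      HasDerivAt (deriv g) (deriv (deriv g) t) t := by
  constructor
  · filter_upwards [hg.eventually (by simp)] with s hs
    exact (hs.differentiableAt (by simp)).hasDerivAt
  · have h : ContDiffAt ℝ 1 (fun s => fderiv ℝ g s 1) t :=
      (hg.fderiv_right (m := 1) (by norm_num)).clm_apply contDiffAt_const
    exact (h.differentiableAt (by simp)).hasDerivAt

/-- A negative second derivative would make `t` a local maximum too; then `d` is locally constant
and its second derivative is zero. -/
theorem deriv_deriv_nonneg_of_isLocalMin {d : ℝ → ℝ} {t : ℝ} (hd : IsLocalMin d t)
    (hc : ContinuousAt d t) : 0 ≤ deriv (deriv d) t := by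
  by_contra! h
  have hmax := isLocalMax_of_deriv_deriv_neg h hd.deriv_eq_zero hc
  have heq : d =ᶠ[𝓝 t] fun _ => d t := by
    filter_upwards [hd, hmax] with s h1 h2
    exact le_antisymm h2 h1
  have : deriv (deriv d) t = 0 := by
    rw [heq.deriv.deriv_eq]
    simp
  exact h.ne this

/-- The barrier principle: `g - f` has a local minimum at the point of contact. -/
theorem deriv_deriv_le_of_eventually_le {f g : ℝ → ℝ} {t f₂ : ℝ} {f₁ : ℝ → ℝ}
    (hf : ∀ᶠ s in 𝓝 t, HasDerivAt f (f₁ s) s) (hf₁ : HasDerivAt f₁ f₂ t)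
    (hg : ContDiffAt ℝ 2 g t) (hle : ∀ᶠ s in 𝓝 t, f s ≤ g s) (heq : f t = g t) :
    f₂ ≤ deriv (deriv g) t := by
  obtain ⟨hg1, hg2⟩ := hg.eventually_hasDerivAt
  have hmin : IsLocalMin (fun s => g s - f s) t := by
    filter_upwards [hle] with s hs
    rw [heq, sub_self]
    linarith
  have hd : deriv (fun s => g s - f s) =ᶠ[𝓝 t] fun s => deriv g s - f₁ s := by
    filter_upwards [hf, hg1] with s h1 h2
    exact (h2.sub h1).deriv
  have h := deriv_deriv_nonneg_of_isLocalMin hmin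
    (hg1.self_of_nhds.sub hf.self_of_nhds).continuousAt
  rw [hd.deriv_eq, HasDerivAt.deriv (f := fun s => deriv g s - f₁ s) (hg2.sub hf₁)] at h
  linarith

theorem hasDerivAt_log_deriv {q q₁ : ℝ → ℝ} {q₂ t : ℝ}
    (hq : ∀ᶠ s in 𝓝 t, HasDerivAt q (q₁ s) s) (hq₁ : HasDerivAt q₁ q₂ t) (h0 : q t ≠ 0) :
    (∀ᶠ s in 𝓝 t, HasDerivAt (fun s => Real.log (q s)) (q₁ s / q s) s) ∧
      HasDerivAt (fun s => q₁ s / q s) (q₂ / q t - (q₁ t / q t) ^ 2) t := by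
  constructor
  · filter_upwards [hq, hq.self_of_nhds.continuousAt.eventually_ne h0] with s h1 h2
    exact h1.log h2
  · refine (hq₁.div hq.self_of_nhds h0).congr_deriv ?_
    field_simp

variable (𝕜 : Type*) [RCLike 𝕜] {V : Type*} [NormedAddCommGroup V] [InnerProductSpace 𝕜 V]
  [NormedSpace ℝ V]

theorem hasDerivAt_re_inner {X Y : ℝ → V} {X' Y' : V} {t : ℝ} (hX : HasDerivAt X X' t)
    (hY : HasDerivAt Y Y' t) : HasDerivAt (fun s => RCLike.re (inner 𝕜 (X s) (Y s)))
      (RCLike.re (inner 𝕜 (X t) Y') + RCLike.re (inner 𝕜 X' (Y t))) t := by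
  have h := (RCLike.reCLM (K := 𝕜)).hasFDerivAt.comp_hasDerivAt t (hX.inner 𝕜 hY)
  refine h.congr_deriv ?_
  simp

theorem hasDerivAt_norm_sq_rclike {X : ℝ → V} {X' : V} {t : ℝ} (hX : HasDerivAt X X' t) :
    HasDerivAt (fun s => ‖X s‖ ^ 2) (2 * RCLike.re (inner 𝕜 (X t) X')) t := by
  have h := hasDerivAt_re_inner 𝕜 hX hX
  simp_rw [← norm_sq_eq_re_inner] at h
  refine h.congr_deriv ?_
  rw [inner_re_symm (𝕜 := 𝕜) X']
  ring

theorem hasDerivAt_log_norm_sq {X X₁ : ℝ → V} {X₂ : V} {t : ℝ}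
    (hX : ∀ᶠ s in 𝓝 t, HasDerivAt X (X₁ s) s) (hX₁ : HasDerivAt X₁ X₂ t) (h0 : X t ≠ 0) :
    (∀ᶠ s in 𝓝 t, HasDerivAt (fun s => Real.log (‖X s‖ ^ 2))
      (2 * RCLike.re (inner 𝕜 (X s) (X₁ s)) / ‖X s‖ ^ 2) s) ∧
      HasDerivAt (fun s => 2 * RCLike.re (inner 𝕜 (X s) (X₁ s)) / ‖X s‖ ^ 2)
        (2 * (‖X₁ t‖ ^ 2 + RCLike.re (inner 𝕜 (X t) X₂)) / ‖X t‖ ^ 2 -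
          (2 * RCLike.re (inner 𝕜 (X t) (X₁ t)) / ‖X t‖ ^ 2) ^ 2) t := by
  refine hasDerivAt_log_deriv (hX.mono fun s hs => hasDerivAt_norm_sq_rclike 𝕜 hs) ?_
    (pow_ne_zero 2 (norm_ne_zero_iff.2 h0))
  refine ((hasDerivAt_re_inner 𝕜 hX.self_of_nhds hX₁).const_mul 2).congr_deriv ?_
  rw [norm_sq_eq_re_inner (𝕜 := 𝕜) (X₁ t)]
  ring

end SecondDerivative

/-! ### The geodesic equation of a condition metric at the centre of a chart -/

namespace CondGeometry

section Chart

variable {𝕜 : Type*} [RCLike 𝕜] {V : Type*} [NormedAddCommGroup V] [InnerProductSpace 𝕜 V]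
  [FiniteDimensional 𝕜 V]

theorem extChartAt_self_eq_zero (p : ℙ 𝕜 V) : extChartAt 𝓘(ℝ, ProjModel 𝕜 V) p p = 0 := by
  have h : projCoord (norm_unitRep p) p = (0 : horizontal 𝕜 (unitRep p)) := by
    have h1 : projCoord (norm_unitRep p) (Projectivization.mk 𝕜 (unitRep p) (unitRep_ne_zero p)) =
        (0 : horizontal 𝕜 (unitRep p)) := by
      have := projCoordVec_add (𝕜 := 𝕜) (norm_unitRep p) 0
      rw [Submodule.coe_zero, add_zero] at this
      exact this
    refine Eq.trans ?_ h1
    congr 1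
    exact (mk_unitRep p).symm
  change horizontalEquiv 𝕜 (norm_unitRep p) (projCoord (norm_unitRep p) p) = 0
  rw [h, map_zero]

theorem extChartAt_symm_apply (p : ℙ 𝕜 V) (u : ProjModel 𝕜 V) :
    (extChartAt 𝓘(ℝ, ProjModel 𝕜 V) p).symm u =
      projParam (norm_unitRep p) ((horizontalEquiv 𝕜 (norm_unitRep p)).symm u) := by
  simp only [mfld_simps]
  rfl

theorem coordForm_fubiniStudy_apply (p : ℙ 𝕜 V) (u a b : ProjModel 𝕜 V) :
    coordForm (fubiniStudy 𝕜 V).inner p u a b =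
      RCLike.re (inner 𝕜 a b) / (1 + ‖u‖ ^ 2) -
        RCLike.re (inner 𝕜 a u * inner 𝕜 u b) / (1 + ‖u‖ ^ 2) ^ 2 :=
  fubiniStudyForm_chart p u a b

theorem contDiff_coordForm_fubiniStudy (p : ℙ 𝕜 V) :
    ContDiff ℝ ∞ (coordForm (fubiniStudy 𝕜 V).inner p) := by
  rw [contDiff_clm_apply_iff]
  intro a
  rw [contDiff_clm_apply_iff]
  intro b
  simp_rw [coordForm_fubiniStudy_apply]
  have hne : ∀ u : ProjModel 𝕜 V, 1 + ‖u‖ ^ 2 ≠ 0 := fun u => by positivity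
  have h1 : ContDiff ℝ ∞ fun u : ProjModel 𝕜 V => 1 + ‖u‖ ^ 2 :=
    contDiff_const.add (contDiff_norm_sq 𝕜)
  have h2 : ContDiff ℝ ∞ fun u : ProjModel 𝕜 V => RCLike.re (inner 𝕜 a u * inner 𝕜 u b) :=
    RCLike.reCLM.contDiff.comp
      ((contDiff_const.inner 𝕜 contDiff_id).mul (contDiff_id.inner 𝕜 contDiff_const))
  exact (contDiff_const.div h1 hne).sub (h2.div (h1.pow 2) fun u => pow_ne_zero 2 (hne u))

theorem coordForm_fubiniStudy_zero (p : ℙ 𝕜 V) (a b : ProjModel 𝕜 V) :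
    coordForm (fubiniStudy 𝕜 V).inner p 0 a b = RCLike.re (inner 𝕜 a b) := by
  rw [coordForm_fubiniStudy_apply]
  simp

/-- The preferred charts are normal to first order for the Fubini-Study metric: its coefficients
are even functions of the coordinates. -/
theorem fderiv_coordForm_fubiniStudy_zero (p : ℙ 𝕜 V) :
    fderiv ℝ (coordForm (fubiniStudy 𝕜 V).inner p) 0 = 0 := by
  set Q := coordForm (fubiniStudy 𝕜 V).inner p with hQ
  have heven : (fun u => Q (-u)) = Q := by
    funext u
    ext a b
    simp [hQ, coordForm_fubiniStudy_apply]
  have h1 : HasFDerivAt Q (fderiv ℝ Q 0) 0 :=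
    ((contDiff_coordForm_fubiniStudy p).differentiable (by simp) 0).hasFDerivAt
  have h2 : HasFDerivAt (fun u => Q (-u))
      (fderiv ℝ Q 0 ∘L (-ContinuousLinearMap.id ℝ (ProjModel 𝕜 V))) 0 := by
    refine HasFDerivAt.comp (0 : ProjModel 𝕜 V) (g := Q) ?_ (hasFDerivAt_id (𝕜 := ℝ) _).neg
    simpa using h1
  rw [heven] at h2
  -- Evenness gives `D = -D` for the derivative at the origin.
  have h3 := h1.unique h2
  ext w a b
  have h4 := congrArg (fun D => D w a b) h3
  simp at h4
  simp
  linarith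

theorem coordForm_conditionMetric (α : ℙ 𝕜 V → ℝ) (p : ℙ 𝕜 V) :
    coordForm (conditionMetric (fubiniStudy 𝕜 V) α) p = fun u =>
      α ((extChartAt 𝓘(ℝ, ProjModel 𝕜 V) p).symm u) • coordForm (fubiniStudy 𝕜 V).inner p u :=
  rfl

theorem fderiv_smul_apply_of_hasFDerivAt_zero {E G : Type*} [NormedAddCommGroup E]
    [NormedSpace ℝ E] [NormedAddCommGroup G] [NormedSpace ℝ G] {β : E → ℝ}
    {Q : E → G} {D : E →L[ℝ] ℝ} {x : E} (hβ : HasFDerivAt β D x)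
    (hQ : HasFDerivAt Q (0 : E →L[ℝ] G) x) (w : E) :
    fderiv ℝ (fun u => β u • Q u) x w = D w • Q x := by
  have h := (hβ.smul hQ).fderiv
  change fderiv ℝ (β • Q) x w = _
  rw [h]
  simp

theorem fderiv_smul_bilinear_apply {E : Type*} [NormedAddCommGroup E] [NormedSpace ℝ E] {β : E → ℝ}
    {Q : E → E →L[ℝ] E →L[ℝ] ℝ} {D : E →L[ℝ] ℝ} {x : E} (hβ : HasFDerivAt β D x)
    (hQ : HasFDerivAt Q (0 : E →L[ℝ] E →L[ℝ] E →L[ℝ] ℝ) x) (w a b : E) :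
    fderiv ℝ (fun u => β u • Q u) x w a b = D w * Q x a b := by
  have h := fderiv_smul_apply_of_hasFDerivAt_zero (G := E →L[ℝ] E →L[ℝ] ℝ) hβ hQ w
  exact congrArg (fun B : E →L[ℝ] E →L[ℝ] ℝ => B a b) h

/-- At the centre the Fubini–Study factor is stationary, so the product rule leaves only the
derivative of `α`. -/
theorem fderiv_coordForm_conditionMetric {α : ℙ 𝕜 V → ℝ} {p : ℙ 𝕜 V}
    {D : ProjModel 𝕜 V →L[ℝ] ℝ}
    (h : HasFDerivAt (fun u => α ((extChartAt 𝓘(ℝ, ProjModel 𝕜 V) p).symm u)) D 0)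
    (w a b : ProjModel 𝕜 V) :
    fderiv ℝ (coordForm (conditionMetric (fubiniStudy 𝕜 V) α) p) 0 w a b =
      D w * RCLike.re (inner 𝕜 a b) := by
  have h1 := ((contDiff_coordForm_fubiniStudy p).differentiable (by simp) 0).hasFDerivAt
  rw [fderiv_coordForm_fubiniStudy_zero] at h1
  rw [← coordForm_fubiniStudy_zero p]
  have h2 := fderiv_smul_bilinear_apply h h1 w a b
  exact h2

/-- The equation of the geodesics of a condition metric, in the preferred chart at a point. -/
theorem IsGeodesicOn.equation_conditionMetric {α : ℙ 𝕜 V → ℝ} {γ : ℝ → ℙ 𝕜 V} {J : Set ℝ}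
    (hγ : IsGeodesicOn (conditionMetric (fubiniStudy 𝕜 V) α) γ J) {t : ℝ} (ht : t ∈ interior J)
    {D : ProjModel 𝕜 V →L[ℝ] ℝ}
    (h : HasFDerivAt (fun u => α ((extChartAt 𝓘(ℝ, ProjModel 𝕜 V) (γ t)).symm u)) D 0)
    (w : ProjModel 𝕜 V) :
    let c : ℝ → ProjModel 𝕜 V := fun s => extChartAt 𝓘(ℝ, ProjModel 𝕜 V) (γ t) (γ s)
    α (γ t) * RCLike.re (inner 𝕜 (deriv (deriv c) t) w) +
      D (deriv c t) * RCLike.re (inner 𝕜 (deriv c t) w) -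
      (1 / 2) * (D w * ‖deriv c t‖ ^ 2) = 0 := by
  intro c
  have heq := hγ.equation t (interior_subset ht) w
  have hJ : ∀ᶠ s in 𝓝 t, J ∈ 𝓝 s := by
    filter_upwards [isOpen_interior.mem_nhds ht] with s hs using mem_interior_iff_mem_nhds.1 hs
  -- At interior points the one-sided derivatives are ordinary ones.
  have h1 : derivWithin c J =ᶠ[𝓝 t] deriv c := by
    filter_upwards [hJ] with s hs using derivWithin_of_mem_nhds hs
  have h2 : derivWithin (derivWithin c J) J t = deriv (deriv c) t := by
    rw [derivWithin_of_mem_nhds hJ.self_of_nhds, h1.deriv_eq]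
  have h0 : extChartAt 𝓘(ℝ, ProjModel 𝕜 V) (γ t) (γ t) = 0 := extChartAt_self_eq_zero _
  simp only at heq
  change coordForm (conditionMetric (fubiniStudy 𝕜 V) α) (γ t)
      (extChartAt 𝓘(ℝ, ProjModel 𝕜 V) (γ t) (γ t)) (derivWithin (derivWithin c J) J t) w +
    fderiv ℝ (coordForm (conditionMetric (fubiniStudy 𝕜 V) α) (γ t))
      (extChartAt 𝓘(ℝ, ProjModel 𝕜 V) (γ t) (γ t)) (derivWithin c J t) (derivWithin c J t) w -
    (1 / 2) * fderiv ℝ (coordForm (conditionMetric (fubiniStudy 𝕜 V) α) (γ t))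
      (extChartAt 𝓘(ℝ, ProjModel 𝕜 V) (γ t) (γ t)) w (derivWithin c J t) (derivWithin c J t) = 0
    at heq
  rw [h0, h2, h1.self_of_nhds, fderiv_coordForm_conditionMetric h,
    fderiv_coordForm_conditionMetric h, coordForm_conditionMetric, ← norm_sq_eq_re_inner] at heq
  have h3 : (extChartAt 𝓘(ℝ, ProjModel 𝕜 V) (γ t)).symm 0 = γ t := by
    rw [← h0]
    exact extChartAt_to_inv _
  simp only [h3] at heq
  rw [smul_apply, smul_apply,
    coordForm_fubiniStudy_zero] at heq
  exact heq

end Chart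

end CondGeometry

/-! ### The barrier and the convexity inequality -/

namespace CondGeometry

section Barrier

variable {𝕜 : Type*} [RCLike 𝕜] {V : Type*} [NormedAddCommGroup V] [InnerProductSpace 𝕜 V]
  [FiniteDimensional 𝕜 V] [NormedSpace ℝ V] [IsScalarTower ℝ 𝕜 V]

/-- The isometry of the model space onto the horizontal space at the unit vector which represents
the point `p`. -/
noncomputable def horizontalLift (p : ℙ 𝕜 V) : ProjModel 𝕜 V →L[ℝ] V :=
  ((horizontal 𝕜 (unitRep p)).subtypeL ∘L
    ((horizontalEquiv 𝕜 (norm_unitRep p)).symm.toContinuousLinearEquiv :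
      ProjModel 𝕜 V →L[𝕜] _)).restrictScalars ℝ

theorem horizontalLift_apply (p : ℙ 𝕜 V) (u : ProjModel 𝕜 V) :
    horizontalLift p u = ((horizontalEquiv 𝕜 (norm_unitRep p)).symm u : V) := rfl

theorem inner_horizontalLift (p : ℙ 𝕜 V) (a b : ProjModel 𝕜 V) :
    inner 𝕜 (horizontalLift p a) (horizontalLift p b) = inner 𝕜 a b :=
  (Submodule.coe_inner _ _ _).symm.trans
    ((horizontalEquiv 𝕜 (norm_unitRep p)).symm.inner_map_map a b)

theorem norm_horizontalLift (p : ℙ 𝕜 V) (a : ProjModel 𝕜 V) : ‖horizontalLift p a‖ = ‖a‖ :=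
  (Submodule.coe_norm _).symm.trans ((horizontalEquiv 𝕜 (norm_unitRep p)).symm.norm_map a)

theorem inner_unitRep_horizontalLift (p : ℙ 𝕜 V) (a : ProjModel 𝕜 V) :
    inner 𝕜 (unitRep p) (horizontalLift p a) = 0 :=
  Submodule.mem_orthogonal_singleton_iff_inner_right.1
    ((horizontalEquiv 𝕜 (norm_unitRep p)).symm a).2

theorem inner_horizontalLift_unitRep (p : ℙ 𝕜 V) (a : ProjModel 𝕜 V) :
    inner 𝕜 (horizontalLift p a) (unitRep p) = 0 :=
  Submodule.mem_orthogonal_singleton_iff_inner_left.1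
    ((horizontalEquiv 𝕜 (norm_unitRep p)).symm a).2

theorem unitRep_add_horizontalLift_ne_zero (p : ℙ 𝕜 V) (u : ProjModel 𝕜 V) :
    unitRep p + horizontalLift p u ≠ 0 :=
  add_horizontal_ne_zero (norm_unitRep p) _

/-- Makes the horizontal part of any vector of `V` available as a test vector in the geodesic
equation. -/
theorem exists_horizontalLift_eq (p : ℙ 𝕜 V) (x : V) :
    ∃ w : ProjModel 𝕜 V, horizontalLift p w = x - inner 𝕜 (unitRep p) x • unitRep p := by
  refine ⟨horizontalEquiv 𝕜 (norm_unitRep p)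
    ((horizontal 𝕜 (unitRep p)).orthogonalProjectionOnto x), ?_⟩
  rw [horizontalLift_apply, LinearIsometryEquiv.symm_apply_apply,
    Submodule.coe_orthogonalProjectionOnto_apply, Submodule.starProjection_orthogonal_val,
      Submodule.starProjection_unit_singleton 𝕜 (norm_unitRep p)]

/-- The function `‖x‖² / f x`, in the preferred chart at `p`. -/
noncomputable def chartRatio (f : V → ℝ) (p : ℙ 𝕜 V) (u : ProjModel 𝕜 V) : ℝ :=
  ‖unitRep p + horizontalLift p u‖ ^ 2 * (f (unitRep p + horizontalLift p u))⁻¹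

theorem chartRatio_eq {α : ℙ 𝕜 V → ℝ} {f : V → ℝ}
    (hα : ∀ (x : V) (hx : x ≠ 0), α (Projectivization.mk 𝕜 x hx) = ‖x‖ ^ 2 * (f x)⁻¹)
    (p : ℙ 𝕜 V) :
    (fun u => α ((extChartAt 𝓘(ℝ, ProjModel 𝕜 V) p).symm u)) = chartRatio f p := by
  funext u
  rw [extChartAt_symm_apply]
  exact hα _ _

theorem contDiffAt_chartRatio {f : V → ℝ} {p : ℙ 𝕜 V} {n : WithTop ℕ∞}
    (hf : ContDiffAt ℝ n f (unitRep p)) (h0 : f (unitRep p) ≠ 0) :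
    ContDiffAt ℝ n (chartRatio (𝕜 := 𝕜) f p) 0 := by
  have hX : ContDiffAt ℝ n (fun u : ProjModel 𝕜 V => unitRep p + horizontalLift p u) 0 :=
    contDiffAt_const.add (horizontalLift p).contDiff.contDiffAt
  have hz : unitRep p + horizontalLift p 0 = unitRep p := by rw [map_zero, add_zero]
  rw [← hz] at hf h0
  exact (hX.norm_sq 𝕜).mul ((hf.comp (0 : ProjModel 𝕜 V) hX).inv h0)

variable {H : Type*} [NormedAddCommGroup H] [InnerProductSpace 𝕜 H] [NormedSpace ℝ H]
  [IsScalarTower ℝ 𝕜 H]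

/-- If `‖R x‖²` touches `f` from above at `z`, then the differentials of `‖x‖² / f x` and
`‖x‖² / ‖R x‖²` at `z` agree. -/
theorem fderiv_chartRatio_apply {f : V → ℝ} {p : ℙ 𝕜 V} {R : V →L[𝕜] H}
    (hf : DifferentiableAt ℝ (chartRatio (𝕜 := 𝕜) f p) 0) (hc : ContinuousAt f (unitRep p))
    (hpos : 0 < f (unitRep p))
    (hle : ∀ x, f x ≤ ‖R x‖ ^ 2) (heq : f (unitRep p) = ‖R (unitRep p)‖ ^ 2)
    (w : ProjModel 𝕜 V) :
    fderiv ℝ (chartRatio (𝕜 := 𝕜) f p) 0 w =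
      -(2 * RCLike.re (inner 𝕜 (R (unitRep p)) (R (horizontalLift p w)))) / f (unitRep p) ^ 2 := by
  set z := unitRep p with hz
  set y := horizontalLift p w with hy
  have hX : HasDerivAt (fun s : ℝ => z + s • y) y 0 := by
    simpa using ((hasDerivAt_id (0 : ℝ)).smul_const y).const_add z
  have hRX : HasDerivAt (fun s : ℝ => R (z + s • y)) (R y) 0 :=
    (R.restrictScalars ℝ).hasFDerivAt.comp_hasDerivAt 0 hX
  have h1 := hasDerivAt_norm_sq_rclike 𝕜 hX
  have h2 := hasDerivAt_norm_sq_rclike 𝕜 hRX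
  have h0 : z + (0 : ℝ) • y = z := by simp
  have hR0 : ‖R (z + (0 : ℝ) • y)‖ ^ 2 ≠ 0 := by rw [h0, ← heq]; exact hpos.ne'
  have h3 := h1.div h2 hR0
  have h4 : HasDerivAt (fun s : ℝ => chartRatio (𝕜 := 𝕜) f p (s • w))
      (fderiv ℝ (chartRatio (𝕜 := 𝕜) f p) 0 w) 0 := by
    have hs : HasDerivAt (fun s : ℝ => s • w) w 0 := by
      simpa using (hasDerivAt_id (0 : ℝ)).smul_const w
    have h : HasFDerivAt (chartRatio (𝕜 := 𝕜) f p) (fderiv ℝ (chartRatio (𝕜 := 𝕜) f p) 0)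
        ((0 : ℝ) • w) := by
      rw [zero_smul]
      exact hf.hasFDerivAt
    exact h.comp_hasDerivAt 0 hs
  have hev : ∀ᶠ s : ℝ in 𝓝 0, 0 < f (z + s • y) := by
    have hc' : ContinuousAt (fun s : ℝ => f (z + s • y)) 0 :=
      ContinuousAt.comp (g := f) (by rw [h0]; exact hc) hX.continuousAt
    have : 0 < f (z + (0 : ℝ) • y) := by rwa [h0]
    exact hc'.eventually (lt_mem_nhds this)
  -- The barrier lies below the ratio and agrees with it at `s = 0`, so their difference is
  -- stationary there.
  have hmin : IsLocalMin (fun s : ℝ => chartRatio (𝕜 := 𝕜) f p (s • w) -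
      ‖z + s • y‖ ^ 2 / ‖R (z + s • y)‖ ^ 2) 0 := by
    filter_upwards [hev] with s hs
    simp only [chartRatio, map_smul, ← hy, ← hz]
    rw [h0, heq, ← div_eq_mul_inv, ← div_eq_mul_inv, sub_self, sub_nonneg]
    exact div_le_div_of_nonneg_left (by positivity) hs (hle _)
  have h5 := hmin.hasDerivAt_eq_zero (h4.sub h3)
  -- Horizontality makes the numerator `‖z + s • y‖²` stationary at `s = 0`; only the derivative of
  -- the denominator remains.
  have hzy : inner 𝕜 z y = 0 := inner_unitRep_horizontalLift p w
  rw [h0, ← heq, hzy, norm_unitRep] at h5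
  rw [sub_eq_zero.1 h5]
  simp

/-- The convexity inequality behind self-convexity, at an interior point of a geodesic. -/
theorem deriv_deriv_log_nonneg [CompleteSpace V] [CompleteSpace H]
    {α : ℙ 𝕜 V → ℝ} {f : V → ℝ}
    (hα : ∀ (x : V) (hx : x ≠ 0), α (Projectivization.mk 𝕜 x hx) = ‖x‖ ^ 2 * (f x)⁻¹)
    {γ : ℝ → ℙ 𝕜 V} {J : Set ℝ} (hγ : IsGeodesicOn (conditionMetric (fubiniStudy 𝕜 V) α) γ J)
    {t : ℝ} (ht : t ∈ interior J) (hf : ContDiffAt ℝ 2 f (unitRep (γ t)))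
    (hpos : 0 < f (unitRep (γ t))) (S : H →ₗᵢ[𝕜] V)
    (hle : ∀ x, f x ≤ ‖S.toContinuousLinearMap.adjoint x‖ ^ 2)
    (heq : f (unitRep (γ t)) = ‖S.toContinuousLinearMap.adjoint (unitRep (γ t))‖ ^ 2)
    (hg : ContDiffAt ℝ 2 (fun s => Real.log (α (γ s))) t) :
    0 ≤ deriv (deriv fun s => Real.log (α (γ s))) t := by
  set p := γ t with hp
  set z := unitRep p with hz
  set R := S.toContinuousLinearMap.adjoint with hR
  set φ := extChartAt 𝓘(ℝ, ProjModel 𝕜 V) p with hφ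
  set c : ℝ → ProjModel 𝕜 V := fun s => φ (γ s) with hc
  set F := f z with hF
  have hzn : ‖z‖ = 1 := norm_unitRep p
  have hγt : ContMDiffAt 𝓘(ℝ, ℝ) 𝓘(ℝ, ProjModel 𝕜 V) 2 γ t :=
    hγ.contMDiffOn.contMDiffAt (mem_interior_iff_mem_nhds.1 ht)
  have hcd : ContDiffAt ℝ 2 c t := by
    rw [← contMDiffAt_iff_contDiffAt]
    exact (contMDiffAt_extChartAt (I := 𝓘(ℝ, ProjModel 𝕜 V)) (x := p)).comp t hγt
  obtain ⟨hc1, hc2⟩ := hcd.eventually_hasDerivAt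
  have hct : c t = 0 := extChartAt_self_eq_zero p
  set v := horizontalLift p (deriv c t) with hv
  set a := horizontalLift p (deriv (deriv c) t) with ha
  -- the curve in `V`
  set X : ℝ → V := fun s => z + horizontalLift p (c s) with hX
  have hXt : X t = z := by simp [hX, hct]
  have hX1 : ∀ᶠ s in 𝓝 t, HasDerivAt X (horizontalLift p (deriv c s)) s := by
    filter_upwards [hc1] with s hs
    exact ((horizontalLift p).hasFDerivAt.comp_hasDerivAt s hs).const_add z
  have hX2 : HasDerivAt (fun s => horizontalLift p (deriv c s)) a t :=
    (horizontalLift p).hasFDerivAt.comp_hasDerivAt t hc2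
  have hRX1 : ∀ᶠ s in 𝓝 t, HasDerivAt (fun s => R (X s)) (R (horizontalLift p (deriv c s))) s := by
    filter_upwards [hX1] with s hs
    exact (R.restrictScalars ℝ).hasFDerivAt.comp_hasDerivAt s hs
  have hRX2 : HasDerivAt (fun s => R (horizontalLift p (deriv c s))) (R a) t :=
    (R.restrictScalars ℝ).hasFDerivAt.comp_hasDerivAt t hX2
  have hRz : R (X t) ≠ 0 := by
    rw [hXt]
    intro h
    rw [h, norm_zero] at heq
    simp [heq] at hpos
  have hXt0 : X t ≠ 0 := unitRep_add_horizontalLift_ne_zero p _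
  obtain ⟨hN1, hN2⟩ := hasDerivAt_log_norm_sq 𝕜 hX1 hX2 hXt0
  obtain ⟨hH1, hH2⟩ := hasDerivAt_log_norm_sq 𝕜 hRX1 hRX2 hRz
  have hαγ : ∀ᶠ s in 𝓝 t, α (γ s) = ‖X s‖ ^ 2 * (f (X s))⁻¹ := by
    filter_upwards [hγt.continuousAt.eventually
      (extChartAt_source_mem_nhds (I := 𝓘(ℝ, ProjModel 𝕜 V)) p)] with s hs
    have h1 := congrFun (chartRatio_eq hα p) (c s)
    simp only [hc, hφ] at h1
    rw [(extChartAt 𝓘(ℝ, ProjModel 𝕜 V) p).left_inv hs] at h1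
    exact h1
  have hXc : ContinuousAt X t := hX1.self_of_nhds.continuousAt
  have hfX : ∀ᶠ s in 𝓝 t, 0 < f (X s) := by
    have hc' : ContinuousAt (fun s => f (X s)) t :=
      ContinuousAt.comp (g := f) (by rw [hXt]; exact hf.continuousAt) hXc
    have : 0 < f (X t) := by rwa [hXt]
    exact hc'.eventually (lt_mem_nhds this)
  -- The barrier `log ‖X‖² - log ‖R X‖²` touches `log α` from below at `t`; it remains to bound its
  -- explicit second derivative.
  have hbar := deriv_deriv_le_of_eventually_le
    (f := fun s => Real.log (‖X s‖ ^ 2) - Real.log (‖R (X s)‖ ^ 2)) (g := fun s => Real.log (α (γ s)))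
    (by filter_upwards [hN1, hH1] with s h1 h2 using h1.sub h2) (hN2.sub hH2) hg
    (by
      filter_upwards [hαγ, hfX, hXc.eventually_ne hXt0] with s h1 h2 h3
      have hn : ‖X s‖ ^ 2 ≠ 0 := pow_ne_zero 2 (norm_ne_zero_iff.2 h3)
      rw [h1, Real.log_mul hn (inv_ne_zero h2.ne'), Real.log_inv, ← sub_eq_add_neg]
      exact sub_le_sub_left (Real.log_le_log h2 (hle _)) _)
    (by
      have hn : ‖X t‖ ^ 2 ≠ 0 := pow_ne_zero 2 (norm_ne_zero_iff.2 hXt0)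
      rw [hαγ.self_of_nhds, hXt, ← heq, Real.log_mul (by rw [hzn]; norm_num) (inv_ne_zero hpos.ne'),
        Real.log_inv, ← sub_eq_add_neg])
  refine le_trans ?_ hbar
  -- the geodesic equation
  have hdiff := (contDiffAt_chartRatio (𝕜 := 𝕜) hf hpos.ne').differentiableAt (by simp)
  have hgeo := hγ.equation_conditionMetric ht (D := fderiv ℝ (chartRatio (𝕜 := 𝕜) f p) 0)
    (by rw [chartRatio_eq hα p]; exact hdiff.hasFDerivAt)
  -- `S (R z)` is half the gradient of `‖R x‖²` at `z`. Pairing with its horizontal part turns the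
  -- acceleration into `⟪R z, R a⟫`, the term that occurs in the second derivative of the barrier.
  obtain ⟨w, hw⟩ := exists_horizontalLift_eq p (S (R z))
  have hD := fderiv_chartRatio_apply (𝕜 := 𝕜) hdiff hf.continuousAt hpos hle heq
  have hRS : ∀ y, R (S y) = y := fun y => by
    refine ext_inner_right 𝕜 fun y' => ?_
    rw [hR, ContinuousLinearMap.adjoint_inner_left]
    exact S.inner_map_map y y'
  have hzS : inner 𝕜 z (S (R z)) = (F : 𝕜) := by
    have : inner 𝕜 z (S (R z)) = inner 𝕜 (R z) (R z) :=
      (ContinuousLinearMap.adjoint_inner_left S.toContinuousLinearMap (R z) z).symm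
    rw [this, inner_self_eq_norm_sq_to_K, heq]
    norm_cast
  have haS : ∀ b : ProjModel 𝕜 V, RCLike.re (inner 𝕜 b w) =
      RCLike.re (inner 𝕜 (R z) (R (horizontalLift p b))) := by
    intro b
    rw [← inner_horizontalLift p, hw, inner_sub_right, inner_smul_right,
      inner_horizontalLift_unitRep, mul_zero, sub_zero, inner_re_symm (𝕜 := 𝕜) (R z) (R (horizontalLift p b))]
    exact congrArg _ (ContinuousLinearMap.adjoint_inner_left S.toContinuousLinearMap (R z) _).symm
  -- `R S = 1` gives the term `F`; removing the component `F • z` along `z` subtracts `F * F`.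
  have hRw : RCLike.re (inner 𝕜 (R z) (R (horizontalLift p w))) = F - F ^ 2 := by
    rw [hw, hzS, map_sub, map_smul, hRS, inner_sub_right, inner_smul_right,
      inner_self_eq_norm_sq_to_K, map_sub, RCLike.re_ofReal_mul]
    norm_cast
    rw [← heq]
    ring
  have hgeo' : α p * RCLike.re (inner 𝕜 (deriv (deriv c) t) w) +
      fderiv ℝ (chartRatio (𝕜 := 𝕜) f p) 0 (deriv c t) * RCLike.re (inner 𝕜 (deriv c t) w) -
        (1 / 2) * (fderiv ℝ (chartRatio (𝕜 := 𝕜) f p) 0 w * ‖deriv c t‖ ^ 2) = 0 := hgeo w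
  have hαp : α p = F⁻¹ := by
    have := hαγ.self_of_nhds
    rwa [hXt, hzn, one_pow, one_mul] at this
  rw [hαp, haS, haS, hD, hD, hRw, ← norm_horizontalLift p (deriv c t)] at hgeo'
  have hRv : ‖R v‖ ≤ ‖v‖ := by
    refine (R.le_opNorm v).trans (mul_le_of_le_one_left (norm_nonneg _) ?_)
    rw [hR, LinearIsometryEquiv.norm_map]
    exact S.norm_toContinuousLinearMap_le
  have hRv2 : ‖R v‖ ^ 2 ≤ ‖v‖ ^ 2 := pow_le_pow_left₀ (norm_nonneg _) hRv 2
  have hza : inner 𝕜 z a = 0 := inner_unitRep_horizontalLift p _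
  have hzv : inner 𝕜 z v = 0 := inner_unitRep_horizontalLift p _
  rw [hXt, ← heq, hza, hzv, hzn]
  rw [map_zero]
  change F⁻¹ * RCLike.re (inner 𝕜 (R z) (R a)) +
    -(2 * RCLike.re (inner 𝕜 (R z) (R v))) / F ^ 2 * RCLike.re (inner 𝕜 (R z) (R v)) -
    1 / 2 * (-(2 * (F - F ^ 2)) / F ^ 2 * ‖v‖ ^ 2) = 0 at hgeo'
  generalize RCLike.re (inner 𝕜 (R z) (R a)) = A at hgeo' ⊢
  generalize RCLike.re (inner 𝕜 (R z) (R v)) = B at hgeo' ⊢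
  -- The geodesic equation solved for `⟪R z, R a⟫`.
  have hA : A = 2 * B ^ 2 / F - (1 - F) * ‖v‖ ^ 2 := by
    field_simp at hgeo' ⊢
    linarith
  -- This is the exact value of the second derivative of the barrier: the terms in `B` cancel.
  have : 0 ≤ 2 * (‖v‖ ^ 2 - ‖R v‖ ^ 2) / F := div_nonneg (by linarith) hpos.le
  refine this.trans_eq ?_
  rw [hA]
  field_simp
  ring

end Barrier

end CondGeometry

/-! ### Application to the condition number -/

namespace CondGeometry

variable {𝕜 : Type*} [RCLike 𝕜] {n m : ℕ}

theorem condNumberSq_mk (A : MatrixSpace 𝕜 n m) (hA : A ≠ 0) :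
    condNumberSq (Projectivization.mk 𝕜 A hA) = ‖A‖ ^ 2 * (singVal A (n - 1) ^ 2)⁻¹ := rfl

theorem mk_mem_projGLgt {A : MatrixSpace 𝕜 n m} (hA : A ≠ 0) :
    Projectivization.mk 𝕜 A hA ∈ projGLgt 𝕜 n m ↔ IsGLgt A := by
  refine ⟨?_, fun h => ⟨A, hA, h, rfl⟩⟩
  rintro ⟨B, hB, hBgt, h⟩
  obtain ⟨c, hc⟩ := (Projectivization.mk_eq_mk_iff' 𝕜 A B hA hB).1 h.symm
  rw [← hc]
  refine isGLgt_smul ?_ hBgt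
  rintro rfl
  exact hA (by rw [← hc, zero_smul])

theorem isGLgt_unitRep {p : ℙ 𝕜 (MatrixSpace 𝕜 n m)} (hp : p ∈ projGLgt 𝕜 n m) :
    IsGLgt (unitRep p) :=
  (mk_mem_projGLgt (unitRep_ne_zero p)).1 (by rwa [mk_unitRep])

/-- The defining conditions are invariant under nonzero scalars, so the preimage under the quotient
map is exactly the open set of such matrices. -/
theorem isOpen_projGLgt : IsOpen (projGLgt 𝕜 n m) := by
  rw [← isQuotientMap_mk'.isOpen_preimage]
  convert isOpen_setOf_isGLgt.preimage
    (continuous_subtype_val (p := fun A : MatrixSpace 𝕜 n m => A ≠ 0)) using 1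
  ext ⟨A, hA⟩
  exact mk_mem_projGLgt hA

theorem condNumberSq_pos {p : ℙ 𝕜 (MatrixSpace 𝕜 n m)} (hp : p ∈ projGLgt 𝕜 n m) :
    0 < condNumberSq p := by
  have h := isGLgt_unitRep hp
  rw [← mk_unitRep p, condNumberSq_mk, norm_unitRep, one_pow, one_mul]
  exact inv_pos.2 (pow_pos h.1 2)

theorem contMDiffAt_condNumberSq (hn : 1 ≤ n) (hnm : n ≤ m) {p : ℙ 𝕜 (MatrixSpace 𝕜 n m)}
    (hp : p ∈ projGLgt 𝕜 n m) :
    ContMDiffAt 𝓘(ℝ, ProjModel 𝕜 (MatrixSpace 𝕜 n m)) 𝓘(ℝ, ℝ) ∞ condNumberSq p := by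
  have hGL := isGLgt_unitRep hp
  have h1 := contDiffAt_chartRatio (contDiffAt_singVal_sq hn hnm hGL) (pow_pos hGL.1 2).ne'
  rw [← chartRatio_eq condNumberSq_mk p, ← extChartAt_self_eq_zero p] at h1
  refine (h1.contMDiffAt.comp p (contMDiffAt_extChartAt
    (I := 𝓘(ℝ, ProjModel 𝕜 (MatrixSpace 𝕜 n m))))).congr_of_eventuallyEq ?_
  filter_upwards [extChartAt_source_mem_nhds
    (I := 𝓘(ℝ, ProjModel 𝕜 (MatrixSpace 𝕜 n m))) p] with q hq
  simp only [Function.comp_apply]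
  rw [(extChartAt 𝓘(ℝ, ProjModel 𝕜 (MatrixSpace 𝕜 n m)) p).left_inv hq]

theorem convexOn_log_condNumberSq (hn : 1 ≤ n) (hnm : n ≤ m) {J : Set ℝ}
    {γ : ℝ → ℙ 𝕜 (MatrixSpace 𝕜 n m)} (hJ : J.OrdConnected)
    (hγJ : Set.MapsTo γ J (projGLgt 𝕜 n m))
    (hγ : IsGeodesicOn (conditionMetric (fubiniStudy 𝕜 (MatrixSpace 𝕜 n m)) condNumberSq) γ J) :
    ConvexOn ℝ J fun t => Real.log (condNumberSq (γ t)) := by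
  have hg : ∀ t ∈ interior J, ContDiffAt ℝ 2 (fun t => Real.log (condNumberSq (γ t))) t := by
    intro t ht
    have h1 := ((contMDiffAt_condNumberSq hn hnm (hγJ (interior_subset ht))).of_le
      (m := 2) (by norm_cast)).comp t
      (hγ.contMDiffOn.contMDiffAt (mem_interior_iff_mem_nhds.1 ht))
    exact (contMDiffAt_iff_contDiffAt.1 h1).log (condNumberSq_pos (hγJ (interior_subset ht))).ne'
  -- The second derivative is needed only in the interior; continuity carries convexity to the end
  -- points that belong to `J`.
  refine convexOn_of_deriv2_nonneg hJ.convex (fun t ht => ?_) (fun t ht => ?_) (fun t ht => ?_)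
    fun t ht => ?_
  · have h1 := (contMDiffAt_condNumberSq hn hnm (hγJ ht)).continuousAt.comp_continuousWithinAt
      (hγ.contMDiffOn.continuousOn t ht)
    exact h1.log (condNumberSq_pos (hγJ ht)).ne'
  · exact ((hg t ht).differentiableAt (by simp)).differentiableWithinAt
  · exact (hg t ht).eventually_hasDerivAt.2.differentiableAt.differentiableWithinAt
  · have hGL := isGLgt_unitRep (hγJ (interior_subset ht))
    -- The barrier is chosen anew at each point of the geodesic, from a left singular vector there.
    obtain ⟨S, hle, heq⟩ := exists_isometry_singVal hGL.1
    exact deriv_deriv_log_nonneg condNumberSq_mk hγ ht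
      ((contDiffAt_singVal_sq hn hnm hGL).of_le (by norm_cast)) (pow_pos hGL.1 2) S
      (fun B => pow_le_pow_left₀ (singVal_nonneg _ _) (hle B) 2) (by rw [heq]) (hg t ht)

end CondGeometry

theorem mainTheorem6 (𝕜 : Type*) [RCLike 𝕜] (n m : ℕ) (hn : 1 ≤ n) (hnm : n ≤ m) :
    CondGeometry.IsSelfConvexOn
      (CondGeometry.fubiniStudy 𝕜 (CondGeometry.MatrixSpace 𝕜 n m))
      CondGeometry.condNumberSq (CondGeometry.projGLgt 𝕜 n m) where
  isOpen := CondGeometry.isOpen_projGLgt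
  contMDiffOn := fun _ hp =>
    ((CondGeometry.contMDiffAt_condNumberSq hn hnm hp).of_le (by norm_cast)).contMDiffWithinAt
  pos := fun _ hp => CondGeometry.condNumberSq_pos hp
  convexOn_log := fun _ _ hJ hγJ hγ =>
    CondGeometry.convexOn_log_condNumberSq hn hnm hJ hγJ hγ
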